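/- **Setting.** Let $k\ge 0$ and let $\Lambda$ be a probability distribution on functions $f:\{\pm1\}^k\to[-1,1]$. Write $\widehat f(T)=2^{-k}\sum_{\sigma}f(\sigma)\prod_{i\in T}\sigma_i$ for the Fourier coefficients, $\|f^{=j}\|^2=\sum_{|T|=j}\widehat f(T)^2$ for the Fourier weights, $\mathbb E_\Lambda[f]=\mathbb E_{f\sim\Lambda}\widehat f(\varnothing)$, and $\xi(s)=\sum_{j=1}^k \mathbb E_{f\sim\Lambda}\|f^{=j}\|^2\, s^j$ (the expected noise stability polynomial without its constant term). Let $\ell,\ell'\ge 1$, let $A\in\{0,1\}^{\ell\times\ell'}$ and $b\in\mathbb R_{\ge 0}^{\ell'}$ satisfy $(Ab)_i=1$ for all $i\in[\ell]$, and let $\alpha,\beta>0$. *Coupled CSP.* For each $i'\in[\ell']$ independently, draw $\lfloor b_{i'}\alpha n\rfloor$ i.i.d. clauses, each given by i.i.d. uniform indices $i_1,\dots,i_k\in[n]$, a function $f\sim\Lambda$ and i.i.d. uniform signs $\varepsilon_1,\dots,\varepsilon_k$; put $\mathcal H'_{i'}(\sigma)=\frac1\alpha\sum_{\text{clauses}}f(\varepsilon_1\sigma_{i_1},\dots,\varepsilon_k\sigma_{i_k})$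 for $\sigma\in\{\pm1\}^n$. Put $\mathcal H_i=\sum_{i'}A_{ii'}\mathcal H'_{i'}$ and let $\mathcal H(\mathbf x)=\sum_{i=1}^\ell\mathcal H_i(\mathbf x_i)$ be the grand Hamiltonian on $(\{\pm1\}^n)^\ell$. *Coupled spin glass.* Let $\mathcal G'_{i'}$ be independent mixed spin glasses with mixture polynomials $b_{i'}\xi$, where the spin glass with mixture polynomial $\sum_{p=1}^k c_p^2s^p$ is $\sum_{p=1}^k c_p n^{-(p-1)/2}\sum_{i_1,\dots,i_p\in[n]}J^{(p)}_{i_1\dots i_p}\sigma_{i_1}\cdots\sigma_{i_p}$ with i.i.d. standard Gaussians $J^{(p)}_{i_1\dots i_p}$ and $c_p\ge 0$. Put $\mathcal G_i=\sum_{i'}A_{ii'}\mathcal G'_{i'}$ and $\mathcal G(\mathbf x)=\sum_i\mathcal G_i(\mathbf x_i)$. *Overlaps.* The overlap vector of $\mathbf x\in(\{\pm1\}^n)^\ell$ has coordinates $R_I(\mathbf x)=\frac1n\sum_{j=1}^n\prod_{i\in I}(\mathbf x_i)_j$, $I\subseteq[\ell]$; $\mathcal R^{(\ell)}\subseteq\mathbb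 R^{2^{[\ell]}}$ is the closure of the set of all overlap vectors (over all $n\ge 1$). For $S\subseteq\mathcal R^{(\ell)}$ let $U_n(S)$ be the set of $\mathbf x\in(\{\pm1\}^n)^\ell$ with overlap vector in $S$, and for $K:(\{\pm1\}^n)^\ell\to\mathbb R$ let $\phi_{K,S}(\beta)=\frac1{\beta\ell n}\log\sum_{\mathbf x\in U_n(S)}e^{\beta K(\mathbf x)}$. **Theorem.** For every $\ell\ge1$ there are constants $C,\varepsilon_0>0$, depending only on $\ell$, such that the following holds for all $k,\Lambda,\ell',A,b$ as above, every set $S\subseteq\mathcal R^{(\ell)}$ and all $\alpha,\beta>0$ with $\beta/\alpha\le\varepsilon_0$. Let $\mathcal H$ and $\mathcal G$ be the grand Hamiltonians of the $(A,b)$-coupled models above, defined for each $n$ on a common probability space with any joint law. There are reals $e_n$ with $|e_n|\le C\beta^2/\alpha^2$ such that, for $n\ge1$ with $U_n(S)\ne\varnothing$, both free energy densities below are integrable and $$\mathbb E\,\phi_{\mathcal H,S}(\beta)=\mathbb E_\Lambda[f]+\frac1{\sqrt\alpha}\,\mathbb E\,\phi_{\mathcal G,S}\!\left(\frac{\beta}{\sqrt\alpha}\right)+e_n+o_n(1),$$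 and also, without expectations, $$\phi_{\mathcal H,S}(\beta)=\mathbb E_\Lambda[f]+\frac1{\sqrt\alpha}\,\phi_{\mathcal G,S}\!\left(\frac{\beta}{\sqrt\alpha}\right)+e_n+r_n,$$ where the random error $r_n$ is $o_n(1)$ with high probability: there are $\delta_n\to0$ and $\eta_n\to0$ with $\Pr[|r_n|\le\delta_n]\ge1-\eta_n$. (Limits are as $n\to\infty$ with all other parameters fixed.) -/

import Mathlib

open MeasureTheory ProbabilityTheory Filter Topology
open scoped BigOperators Matrix

namespace CSPGlass

/-- The alphabet `{±1}`. -/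
abbrev Spin : Type := ℤˣ

/-- The real number `±1` of a spin. -/
def Spin.toReal (s : Spin) : ℝ := ((s : ℤ) : ℝ)

/-- Assignments (configurations) in `{±1}^n`. -/
abbrev Config (n : ℕ) : Type := Fin n → Spin

/-- Hamiltonians on `{±1}^n`. -/
abbrev Hamiltonian (n : ℕ) : Type := Config n → ℝ

/-- Functions `f : {±1}^k → [-1,1]`. -/
abbrev Predicate (k : ℕ) : Type := Config k → Set.Icc (-1 : ℝ) 1

noncomputable section

/-! ### Fourier analysis on the hypercube -/

/-- The Fourier coefficient of `f` at `T ⊆ [k]`: the average of `f(σ) ∏_{i ∈ T} σ_i` over the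
uniform `σ ∈ {±1}^k`. -/
def fourierCoeff {k : ℕ} (f : Predicate k) (T : Finset (Fin k)) : ℝ :=
  (1 / (2 : ℝ) ^ k) * ∑ σ : Config k, (f σ : ℝ) * ∏ i ∈ T, (σ i).toReal

/-- The Fourier weight of `f` at level `j`: the sum of the squared Fourier coefficients at the
sets of size `j`. -/
def fourierWeight {k : ℕ} (f : Predicate k) (j : ℕ) : ℝ :=
  ∑ T ∈ (Finset.univ : Finset (Finset (Fin k))).filter (fun T => T.card = j),
    fourierCoeff f T ^ 2

/-- The mixture polynomial associated to `Λ`: the expected noise stability polynomial without its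
constant term. -/
def mixture {k : ℕ} (Λ : Measure (Predicate k)) : Polynomial ℝ :=
  ∑ j ∈ Finset.Icc 1 k, Polynomial.monomial j (∫ f, fourierWeight f j ∂Λ)

/-- The expected value `E_{f ∼ Λ}[f]`, where `f` is evaluated at a uniform point, i.e. the
expectation of the Fourier coefficient at `∅`. -/
def meanValue {k : ℕ} (Λ : Measure (Predicate k)) : ℝ :=
  ∫ f, fourierCoeff f ∅ ∂Λ

/-! ### Random constraint satisfaction problems -/

/-- A clause on `n` variables: the indices `i_1, …, i_k`, the function `f` and the signs
`ε_1, …, ε_k`. -/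
abbrev Clause (k n : ℕ) : Type := (Fin k → Fin n) × Predicate k × Config k

/-- The value `f(ε_1 σ_{i_1}, …, ε_k σ_{i_k})` of a clause at an assignment. -/
def Clause.value {k n : ℕ} (e : Clause k n) (σ : Config n) : ℝ :=
  (e.2.1 (fun a => e.2.2 a * σ (e.1 a)) : ℝ)

/-- The law of a random clause: i.i.d. uniform indices, `f ∼ Λ` and i.i.d. uniform signs, all
independent. -/
def clauseLaw {k : ℕ} (Λ : Measure (Predicate k)) (n : ℕ) : Measure (Clause k n) :=
  (Measure.pi fun _ : Fin k => uniformOn (Set.univ : Set (Fin n))).prod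
    (Λ.prod (Measure.pi fun _ : Fin k => uniformOn (Set.univ : Set Spin)))

/-- The Hamiltonian of `m` clauses, with the normalization `1/α`. -/
def cspHamiltonian {k n m : ℕ} (α : ℝ) (E : Fin m → Clause k n) : Hamiltonian n :=
  fun σ => (1 / α) * ∑ e : Fin m, (E e).value σ

/-- The law of the Hamiltonian of `⌊b α n⌋` i.i.d. random clauses, normalized by `1/α`.
For `b = 1` this is the model of clause density `α`. -/
def cspLaw {k : ℕ} (Λ : Measure (Predicate k)) (α b : ℝ) (n : ℕ) : Measure (Hamiltonian n) :=
  (Measure.pi fun _ : Fin ⌊b * α * n⌋₊ => clauseLaw Λ n).map (cspHamiltonian α)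

/-! ### Mean-field spin glasses -/

/-- Disorder coefficients: a tensor of order `p + 1` with axes of length `n`, for each `p < k`. -/
abbrev Disorder (k n : ℕ) : Type := (p : Fin k) → (Fin ((p : ℕ) + 1) → Fin n) → ℝ

/-- Gaussian disorder: all the entries are i.i.d. standard Gaussians. -/
def gaussianDisorder (k n : ℕ) : Measure (Disorder k n) :=
  Measure.pi fun _ => Measure.pi fun _ => gaussianReal 0 1

/-- The Hamiltonian of the mixed spin glass with mixture polynomial `ξ` (of degree at most `k`).
The index `p` stands for the interactions of order `p + 1`, with coefficient
`c_{p+1} = √(ξ.coeff (p + 1))` and normalization `n^{-p/2}`. -/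
def sgHamiltonian {k : ℕ} (ξ : Polynomial ℝ) {n : ℕ} (J : Disorder k n) : Hamiltonian n :=
  fun σ => ∑ p : Fin k, √(ξ.coeff ((p : ℕ) + 1)) / √((n : ℝ) ^ (p : ℕ)) *
    ∑ i : Fin ((p : ℕ) + 1) → Fin n, J p i * ∏ a, (σ (i a)).toReal

/-- The law of the mixed spin glass with mixture polynomial `ξ` of degree at most `k`. -/
def sgLaw (k : ℕ) (ξ : Polynomial ℝ) (n : ℕ) : Measure (Hamiltonian n) :=
  (gaussianDisorder k n).map (sgHamiltonian ξ)

/-! ### Coupled models -/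

/-- The parameters of a coupled model: `A` is a `0`-`1` matrix and `b` is a nonnegative vector
with `A b = (1, …, 1)`. -/
structure IsCoupling {ℓ ℓ' : ℕ} (A : Matrix (Fin ℓ) (Fin ℓ') ℝ) (b : Fin ℓ' → ℝ) : Prop where
  zero_or_one : ∀ i i', A i i' = 0 ∨ A i i' = 1
  nonneg : ∀ i', 0 ≤ b i'
  mulVec_eq_one : ∀ i, (A *ᵥ b) i = 1

/-- The random Hamiltonians `H_1, …, H_ℓ` are the linear combinations, given by `A`, of independent
hidden Hamiltonians with the laws `μ 1, …, μ ℓ'`. -/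
def IsCoupled {ℓ ℓ' n : ℕ} (A : Matrix (Fin ℓ) (Fin ℓ') ℝ) (μ : Fin ℓ' → Measure (Hamiltonian n))
    {Ω : Type*} [MeasurableSpace Ω] (P : Measure Ω) (H : Fin ℓ → Ω → Hamiltonian n) : Prop :=
  ∃ H' : Fin ℓ' → Ω → Hamiltonian n,
    (∀ i', HasLaw (H' i') (μ i') P) ∧ iIndepFun H' P ∧
    ∀ i ω σ, H i ω σ = ∑ i', A i i' * H' i' ω σ

/-- The `(A, b)`-coupled model of the random CSP: the hidden instance `i'` has `⌊b_{i'} α n⌋`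
clauses, each with the weight `1/α`. -/
def IsCoupledCSP {k : ℕ} (Λ : Measure (Predicate k)) (α : ℝ) {ℓ ℓ' : ℕ}
    (A : Matrix (Fin ℓ) (Fin ℓ') ℝ) (b : Fin ℓ' → ℝ) {n : ℕ}
    {Ω : Type*} [MeasurableSpace Ω] (P : Measure Ω) (H : Fin ℓ → Ω → Hamiltonian n) : Prop :=
  IsCoupled A (fun i' => cspLaw Λ α (b i') n) P H

/-- The `(A, b)`-coupled model of the spin glass with mixture polynomial `ξ` of degree at most `k`:
the hidden instance `i'` is a spin glass with mixture polynomial `b_{i'} ξ`. -/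
def IsCoupledSG (k : ℕ) (ξ : Polynomial ℝ) {ℓ ℓ' : ℕ}
    (A : Matrix (Fin ℓ) (Fin ℓ') ℝ) (b : Fin ℓ' → ℝ) {n : ℕ}
    {Ω : Type*} [MeasurableSpace Ω] (P : Measure Ω) (G : Fin ℓ → Ω → Hamiltonian n) : Prop :=
  IsCoupled A (fun i' => sgLaw k (Polynomial.C (b i') * ξ) n) P G

/-- The grand Hamiltonian `x ↦ ∑_i H_i(x_i)`. -/
def grand {ℓ n : ℕ} (H : Fin ℓ → Hamiltonian n) (x : Fin ℓ → Config n) : ℝ :=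
  ∑ i, H i (x i)

/-! ### Overlaps and restricted free energies -/

/-- The overlap vector of `x_1, …, x_ℓ`: its `I`-th coordinate is the `I`-overlap
`(1/n) ∑_j ∏_{i ∈ I} (x_i)_j`. -/
def overlapVector {ℓ n : ℕ} (x : Fin ℓ → Config n) : Finset (Fin ℓ) → ℝ :=
  fun I => (1 / (n : ℝ)) * ∑ j : Fin n, ∏ i ∈ I, (x i j).toReal

/-- The overlap polytope: the closure of the set of all overlap vectors, over all `n ≥ 1`. -/
def overlapPolytope (ℓ : ℕ) : Set (Finset (Fin ℓ) → ℝ) :=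
  closure {q | ∃ n : ℕ, 0 < n ∧ ∃ x : Fin ℓ → Config n, q = overlapVector x}

/-- The tuples of assignments in `({±1}^n)^ℓ` whose overlap vector lies in `S`. -/
def overlapPreimage {ℓ : ℕ} (n : ℕ) (S : Set (Finset (Fin ℓ) → ℝ)) : Set (Fin ℓ → Config n) :=
  {x | overlapVector x ∈ S}

open Classical in
/-- The partition function of `K`, restricted to the tuples with overlap vector in `S`. -/
def partitionFunction {ℓ n : ℕ} (S : Set (Finset (Fin ℓ) → ℝ)) (β : ℝ)
    (K : (Fin ℓ → Config n) → ℝ) : ℝ :=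
  ∑ x ∈ Finset.univ.filter (fun x => x ∈ overlapPreimage n S), Real.exp (β * K x)

/-- The free energy density of `K`, restricted to the tuples with overlap vector in `S`. -/
def freeEnergyDensity {ℓ n : ℕ} (S : Set (Finset (Fin ℓ) → ℝ)) (β : ℝ)
    (K : (Fin ℓ → Config n) → ℝ) : ℝ :=
  1 / (β * ℓ * n) * Real.log (partitionFunction S β K)

end

end CSPGlass

/-! The proof is a Lindeberg exchange on the log-partition function, followed by Chebyshev's
inequality.

Put `t = β/α`. One clause of the hidden instance `i'` adds to the exponent the random field `x ↦ t
∑_j A_{ji'} f(ε·(x_j)_i)`, of sup norm at most `tℓ`. The random signs make its mean constant in `x`,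
and by Fourier analysis its second moments depend on overlaps only: before scaling by `t`, they are
those of a centred Gaussian field built from `ξ`, plus a constant (`integral_value_mul_value`,
`cov_clauseField`). In the second order expansion of log-sum-exp around a field `w`, second moments
enter through `∑ p(x) C(x,x) - ∑∑ p(x) p(z) C(x,z)`, where `p` is the Gibbs measure of `w`; a
constant cancels there. Hence replacing a clause by its Gaussian field shifts the expectation by the
mean, up to `O(t^3)` uniformly in `w` (`exchange_of_covariance`), and such replacements compose
under convolution (`Exchange.conv`).

The per-clause cost carries the column sum `∑_j A_{ji'}`. Since `A b = 1`, the weighted number of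
clauses is at most `ℓαn`, whatever `ℓ'` and `b` are. Dividing `ℓαn · O(t^3)` by `βℓn` leaves
`O(β²/α²)` with a constant depending on `ℓ` only. The independent Gaussian fields of an instance
merge into the field of its hidden spin glass because variances add; rounding `b_{i'}αn` down costs
`O(1)` per instance, which vanishes after division by `n`.

For the version without expectations, log-sum-exp is `1`-Lipschitz in the sup norm. By the
Efron–Stein principle its variance under a sum of independent fields is at most the sum of their
second moments (`VarianceBound.conv`). This is `O(n)` in both models, so both free energy densities
have variance `O(1/n)`. -/

set_option linter.unusedSectionVars false

/-! ### Laws with exponential moments and their convolutions -/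

section Generic

/-- A property of families of measures, with an additive parameter, that holds for Dirac masses at
`0` and is closed under convolution passes to the laws of sums of independent variables. -/
theorem law_sum_induction {E Ω τ ι M : Type*} [AddCommMonoid E] [MeasurableSpace E]
    [MeasurableAdd₂ E] [AddCommMonoid M] [MeasurableSpace Ω] {P : Measure Ω}
    [IsProbabilityMeasure P] (r : (τ → Measure E) → M → Prop)
    (hzero : r (fun _ => Measure.dirac 0) 0)
    (hconv : ∀ μ ν c d, r μ c → r ν d → r (fun a => Measure.conv (μ a) (ν a)) (c + d))
    (X : τ → ι → Ω → E) (hX : ∀ a i, AEMeasurable (X a i) P) (hind : ∀ a, iIndepFun (X a) P)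
    (c : ι → M) (s : Finset ι) (h : ∀ i ∈ s, r (fun a => P.map (X a i)) (c i)) :
    r (fun a => P.map (fun ω => ∑ i ∈ s, X a i ω)) (∑ i ∈ s, c i) := by
  classical
  induction s using Finset.induction_on with
  | empty => simpa using hzero
  | insert i s hi ih =>
    have key : ∀ a, P.map (fun ω => ∑ j ∈ insert i s, X a j ω)
        = Measure.conv (P.map (X a i)) (P.map (fun ω => ∑ j ∈ s, X a j ω)) := by
      intro a
      have h1 := ((hind a).indepFun_finsetSum_of_notMem₀ (hX a) hi).symm
      have h2 := IndepFun.map_add_eq_map_conv_map₀ (hX a i)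
        (Finset.aemeasurable_sum s fun j _ => hX a j) h1
      have h3 : (∑ j ∈ s, X a j) = fun ω => ∑ j ∈ s, X a j ω := by
        ext ω; simp
      rw [← h3, ← h2]
      congr 1
      ext ω
      simp [Finset.sum_insert hi]
    rw [Finset.sum_insert hi]
    simp_rw [key]
    exact hconv _ _ _ _ (h i (Finset.mem_insert_self _ _))
      (ih fun j hj => h j (Finset.mem_insert_of_mem hj))

/-- The case of a single family of independent variables. -/
theorem law_sum_induction_single {E Ω ι M : Type*} [AddCommMonoid E] [MeasurableSpace E]
    [MeasurableAdd₂ E] [AddCommMonoid M] [MeasurableSpace Ω] {P : Measure Ω}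
    [IsProbabilityMeasure P] (r : Measure E → M → Prop)
    (hzero : r (Measure.dirac 0) 0)
    (hconv : ∀ μ ν c d, r μ c → r ν d → r (Measure.conv μ ν) (c + d))
    (X : ι → Ω → E) (hX : ∀ i, AEMeasurable (X i) P) (hind : iIndepFun X P)
    (c : ι → M) (s : Finset ι) (h : ∀ i ∈ s, r (P.map (X i)) (c i)) :
    r (P.map (fun ω => ∑ i ∈ s, X i ω)) (∑ i ∈ s, c i) :=
  law_sum_induction (τ := Unit) (fun μ c => r (μ ()) c) hzero
    (fun _ _ _ _ hμ hν => hconv _ _ _ _ hμ hν) (fun _ => X) (fun _ => hX) (fun _ => hind) c s h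

/-! ### Exponential moments, variance bounds and exchange estimates -/

variable {E : Type*} [NormedAddCommGroup E] [MeasurableSpace E] [BorelSpace E]
  [SecondCountableTopology E]

/-- A probability measure all of whose exponential moments are finite. -/
structure ExpMoments (μ : Measure E) : Prop where
  prob : IsProbabilityMeasure μ
  integrable : ∀ c : ℝ, Integrable (fun w => Real.exp (c * ‖w‖)) μ

theorem ExpMoments.integrable_of_le {μ : Measure E} (hμ : ExpMoments μ) {f : E → ℝ}
    (hf : AEStronglyMeasurable f μ) (C c : ℝ) (h : ∀ w, |f w| ≤ C * Real.exp (c * ‖w‖)) :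
    Integrable f μ :=
  ((hμ.integrable c).const_mul C).mono' hf (ae_of_all _ h)

theorem expMoments_dirac (x : E) : ExpMoments (Measure.dirac x) :=
  ⟨inferInstance, fun c => integrable_dirac (by simp)⟩

theorem expMoments_map {Ω : Type*} [MeasurableSpace Ω] {P : Measure Ω} [IsProbabilityMeasure P]
    {X : Ω → E} (hX : AEMeasurable X P) (h : ∀ c : ℝ, Integrable (fun ω => Real.exp (c * ‖X ω‖)) P) :
    ExpMoments (P.map X) := by
  refine ⟨Measure.isProbabilityMeasure_map hX, fun c => ?_⟩
  rw [integrable_map_measure (by fun_prop) hX]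
  exact h c

theorem expMoments_map_of_le {Ω : Type*} [MeasurableSpace Ω] {P : Measure Ω}
    [IsProbabilityMeasure P] {X : Ω → E} (hX : AEMeasurable X P) (B : ℝ) (h : ∀ ω, ‖X ω‖ ≤ B) :
    ExpMoments (P.map X) := by
  refine expMoments_map hX fun c => ?_
  refine Integrable.of_bound (C := Real.exp (|c| * B)) ?_ (ae_of_all _ fun ω => ?_)
  · exact (by fun_prop : Measurable fun w : E => Real.exp (c * ‖w‖)).comp_aemeasurable hX
      |>.aestronglyMeasurable
  · rw [Real.norm_eq_abs, Real.abs_exp, Real.exp_le_exp]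
    calc c * ‖X ω‖ ≤ |c| * ‖X ω‖ := by gcongr; exact le_abs_self c
      _ ≤ |c| * B := by gcongr; exact h ω

theorem exp_norm_add_le (c : ℝ) (x y : E) :
    Real.exp (c * ‖x + y‖) ≤ Real.exp (|c| * ‖x‖) * Real.exp (|c| * ‖y‖) := by
  rw [← Real.exp_add, Real.exp_le_exp, ← mul_add]
  calc c * ‖x + y‖ ≤ |c| * ‖x + y‖ := by gcongr; exact le_abs_self c
    _ ≤ |c| * (‖x‖ + ‖y‖) := by gcongr; exact norm_add_le x y

theorem ExpMoments.conv {μ ν : Measure E} (hμ : ExpMoments μ) (hν : ExpMoments ν) :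
    ExpMoments (Measure.conv μ ν) := by
  have := hμ.prob
  have := hν.prob
  refine ⟨inferInstance, fun c => ?_⟩
  unfold Measure.conv
  rw [integrable_map_measure (by fun_prop) (by fun_prop)]
  refine ((hμ.integrable |c|).mul_prod (hν.integrable |c|)).mono' (by fun_prop)
    (ae_of_all _ fun z => ?_)
  simpa using exp_norm_add_le c z.1 z.2

theorem integral_conv_of_le {μ ν : Measure E} (hμ : ExpMoments μ) (hν : ExpMoments ν) {f : E → ℝ}
    (hf : Continuous f) (C c : ℝ) (h : ∀ w, |f w| ≤ C * Real.exp (c * ‖w‖)) :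
    ∫ w, f w ∂(Measure.conv μ ν) = ∫ x, ∫ y, f (x + y) ∂ν ∂μ := by
  have := hμ.prob
  have := hν.prob
  exact integral_conv ((hμ.conv hν).integrable_of_le hf.aestronglyMeasurable C c h)

theorem abs_le_of_lipschitz {F : E → ℝ} (hF : LipschitzWith 1 F) (w : E) :
    |F w| ≤ (|F 0| + 1) * Real.exp (1 * ‖w‖) := by
  have h1 : |F w - F 0| ≤ ‖w‖ := by
    simpa [Real.dist_eq] using hF.dist_le_mul w 0
  have h2 := Real.add_one_le_exp ‖w‖
  have h3 : |F w| ≤ |F w - F 0| + |F 0| := by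
    simpa using abs_add_le (F w - F 0) (F 0)
  have h4 := Real.one_le_exp (norm_nonneg w)
  rw [one_mul]
  nlinarith [abs_nonneg (F 0)]

theorem sq_le_of_lipschitz {F : E → ℝ} (hF : LipschitzWith 1 F) (w : E) :
    |F w ^ 2| ≤ (|F 0| + 1) ^ 2 * Real.exp (2 * ‖w‖) := by
  have h := abs_le_of_lipschitz hF w
  rw [abs_pow, two_mul, Real.exp_add, ← sq, ← mul_pow]
  rw [one_mul] at h
  exact pow_le_pow_left₀ (abs_nonneg _) h 2

theorem ExpMoments.integrable_lipschitz {μ : Measure E} (hμ : ExpMoments μ) {F : E → ℝ}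
    (hF : LipschitzWith 1 F) : Integrable F μ :=
  hμ.integrable_of_le hF.continuous.aestronglyMeasurable _ _ (abs_le_of_lipschitz hF)

theorem ExpMoments.memLp_lipschitz {μ : Measure E} (hμ : ExpMoments μ) {F : E → ℝ}
    (hF : LipschitzWith 1 F) : MemLp F 2 μ := by
  rw [memLp_two_iff_integrable_sq hF.continuous.aestronglyMeasurable]
  exact hμ.integrable_of_le (hF.continuous.pow 2).aestronglyMeasurable _ _ (sq_le_of_lipschitz hF)

theorem lipschitz_comp_const_add {F : E → ℝ} (hF : LipschitzWith 1 F) (x : E) :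
    LipschitzWith 1 (fun y => F (x + y)) := by
  refine LipschitzWith.of_dist_le_mul fun a b => ?_
  simpa using hF.dist_le_mul (x + a) (x + b)

/-- A shift of `x` moves `F (x + y)` by at most the same amount for every `y`, so averaging over `y`
preserves the constant. Partial averages thus stay in the class of test functions for variance
bounds and exchanges. -/
theorem lipschitz_integral {ν : Measure E} (hν : ExpMoments ν) {F : E → ℝ}
    (hF : LipschitzWith 1 F) : LipschitzWith 1 (fun x => ∫ y, F (x + y) ∂ν) := by
  have := hν.prob
  refine LipschitzWith.of_dist_le_mul fun a b => ?_
  rw [Real.dist_eq, ← integral_sub (hν.integrable_lipschitz (lipschitz_comp_const_add hF a))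
    (hν.integrable_lipschitz (lipschitz_comp_const_add hF b))]
  have h := norm_integral_le_of_norm_le_const (μ := ν) (C := dist a b)
    (f := fun y => F (a + y) - F (b + y)) (ae_of_all _ fun y => by
      simpa [Real.dist_eq] using hF.dist_le_mul (a + y) (b + y))
  simpa using h

/-- All `1`-Lipschitz functions have variance at most `c` under `μ`. -/
def VarianceBound (μ : Measure E) (c : ℝ) : Prop :=
  ExpMoments μ ∧ ∀ F : E → ℝ, LipschitzWith 1 F → Var[F; μ] ≤ c

/-- The variance is at most the second moment around any constant; with the constant `F 0`, the
Lipschitz property gives `|F w - F 0| ≤ ‖w‖`. -/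
theorem varianceBound_of_integral_sq_le {μ : Measure E} (hμ : ExpMoments μ) {c : ℝ}
    (h : ∫ w, ‖w‖ ^ 2 ∂μ ≤ c) : VarianceBound μ c := by
  have := hμ.prob
  refine ⟨hμ, fun F hF => ?_⟩
  have hsq : ∀ w : E, ‖w‖ ^ 2 ≤ 2 * Real.exp (1 * ‖w‖) := fun w => by
    have := Real.pow_div_factorial_le_exp ‖w‖ (norm_nonneg w) 2
    rw [one_mul]
    norm_num [Nat.factorial] at this
    linarith
  rw [← variance_sub_const hF.continuous.aestronglyMeasurable (F 0)]
  refine (variance_le_expectation_sq (hF.continuous.sub continuous_const).aestronglyMeasurable).trans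
    (le_trans ?_ h)
  refine integral_mono_of_nonneg (ae_of_all _ fun w => sq_nonneg _) ?_ (ae_of_all _ fun w => ?_)
  · exact hμ.integrable_of_le (by fun_prop) 2 1 fun w => by
      rw [abs_of_nonneg (by positivity)]; exact hsq w
  · have h1 : |F w - F 0| ≤ ‖w‖ := by simpa [Real.dist_eq] using hF.dist_le_mul w 0
    simpa using pow_le_pow_left₀ (abs_nonneg _) h1 2

theorem varianceBound_dirac_zero : VarianceBound (Measure.dirac (0 : E)) 0 :=
  varianceBound_of_integral_sq_le (expMoments_dirac 0) (by simp)

/-- This is the law of total variance: with `M x` the mean of `F (x + y)` over `y`, the variance of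
`F (x + y)` is the average of the conditional variances, each at most `d`, plus the variance of `M`,
which is again `1`-Lipschitz. -/
theorem VarianceBound.conv {μ ν : Measure E} {c d : ℝ} (hμ : VarianceBound μ c)
    (hν : VarianceBound ν d) : VarianceBound (Measure.conv μ ν) (c + d) := by
  obtain ⟨hμ, hμ'⟩ := hμ
  obtain ⟨hν, hν'⟩ := hν
  have := hμ.prob
  have := hν.prob
  refine ⟨hμ.conv hν, fun F hF => ?_⟩
  have hM := lipschitz_integral hν hF
  set M : E → ℝ := fun x => ∫ y, F (x + y) ∂ν with hMdef
  have h1 := variance_eq_sub ((hμ.conv hν).memLp_lipschitz hF)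
  have h2 := variance_eq_sub (hμ.memLp_lipschitz hM)
  have h3 : ∀ x, ∫ y, F (x + y) ^ 2 ∂ν ≤ d + M x ^ 2 := fun x => by
    have h := hν' _ (lipschitz_comp_const_add hF x)
    rw [variance_eq_sub (hν.memLp_lipschitz (lipschitz_comp_const_add hF x))] at h
    simp only [Pi.pow_apply] at h
    linarith
  have h4 : ∫ w, F w ^ 2 ∂(Measure.conv μ ν) = ∫ x, ∫ y, F (x + y) ^ 2 ∂ν ∂μ :=
    integral_conv_of_le hμ hν (hF.continuous.pow 2) _ _ (sq_le_of_lipschitz hF)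
  have h5 : ∫ w, F w ∂(Measure.conv μ ν) = ∫ x, M x ∂μ :=
    integral_conv_of_le hμ hν hF.continuous _ _ (abs_le_of_lipschitz hF)
  have hM2 : Integrable (fun x => M x ^ 2) μ := (hμ.memLp_lipschitz hM).integrable_sq
  have h6 : ∫ x, ∫ y, F (x + y) ^ 2 ∂ν ∂μ ≤ d + ∫ x, M x ^ 2 ∂μ := by
    calc ∫ x, ∫ y, F (x + y) ^ 2 ∂ν ∂μ ≤ ∫ x, (d + M x ^ 2) ∂μ :=
          integral_mono_of_nonneg (ae_of_all _ fun x => integral_nonneg fun y => sq_nonneg _)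
            ((integrable_const d).add hM2) (ae_of_all _ h3)
      _ = d + ∫ x, M x ^ 2 ∂μ := by
          rw [integral_add (integrable_const d) hM2]; simp
  have h7 := hμ' M hM
  simp only [Pi.pow_apply] at h1 h2
  rw [h1, h4, h5]
  linarith

/-- Replacing an independent summand of law `μ` by one of law `ν` changes the expectation of `F`
by `m`, up to an error of at most `c`. -/
structure Exchange (F : E → ℝ) (μ ν : Measure E) (m c : ℝ) : Prop where
  left : ExpMoments μ
  right : ExpMoments ν
  bound : ∀ w, |∫ y, F (w + y) ∂μ - m - ∫ y, F (w + y) ∂ν| ≤ c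

theorem Exchange.refl {μ : Measure E} (F : E → ℝ) (hμ : ExpMoments μ) : Exchange F μ μ 0 0 :=
  ⟨hμ, hμ, fun w => by simp⟩

/-- The bound of an exchange is uniform in the background `w`, so it survives averaging over an
additional independent background. -/
theorem Exchange.conv_left {F : E → ℝ} (hF : LipschitzWith 1 F) {μ ν ρ : Measure E} {m c : ℝ}
    (h : Exchange F μ ν m c) (hρ : ExpMoments ρ) :
    Exchange F (Measure.conv ρ μ) (Measure.conv ρ ν) m c := by
  have := hρ.prob
  refine ⟨hρ.conv h.left, hρ.conv h.right, fun w => ?_⟩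
  have key : ∀ {μ' : Measure E}, ExpMoments μ' → ∫ y, F (w + y) ∂(Measure.conv ρ μ')
      = ∫ x, ∫ y, F (w + x + y) ∂μ' ∂ρ ∧ Integrable (fun x => ∫ y, F (w + x + y) ∂μ') ρ := by
    intro μ' hμ'
    have hl := lipschitz_comp_const_add hF w
    constructor
    · rw [integral_conv_of_le hρ hμ' hl.continuous _ _ (abs_le_of_lipschitz hl)]
      simp_rw [add_assoc]
    · exact hρ.integrable_lipschitz (lipschitz_comp_const_add (lipschitz_integral hμ' hF) w)
  obtain ⟨h1, i1⟩ := key h.left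
  obtain ⟨h2, i2⟩ := key h.right
  have h3 : ∫ y, F (w + y) ∂(Measure.conv ρ μ) - m - ∫ y, F (w + y) ∂(Measure.conv ρ ν)
      = ∫ x, (∫ y, F (w + x + y) ∂μ - m - ∫ y, F (w + x + y) ∂ν) ∂ρ := by
    have i3 : Integrable (fun x => ∫ y, F (w + x + y) ∂μ - m) ρ := i1.sub (integrable_const m)
    rw [integral_sub i3 i2, integral_sub i1 (integrable_const m), h1, h2]
    simp
  rw [h3]
  simpa using norm_integral_le_of_norm_le_const (μ := ρ) (C := c)
    (f := fun x => ∫ y, F (w + x + y) ∂μ - m - ∫ y, F (w + x + y) ∂ν)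
    (ae_of_all _ fun x => h.bound (w + x))

theorem Exchange.trans {F : E → ℝ} {μ ν ρ : Measure E} {m m' c c' : ℝ}
    (h : Exchange F μ ν m c) (h' : Exchange F ν ρ m' c') : Exchange F μ ρ (m + m') (c + c') := by
  refine ⟨h.left, h'.right, fun w => ?_⟩
  have h1 := h.bound w
  have h2 := h'.bound w
  rw [abs_le] at *
  constructor <;> linarith [h1.1, h1.2, h2.1, h2.2]

/-- The Lindeberg step: replace one summand while the other serves as background, then replace the
other. Both the shifts `m` and the errors `c` add up. -/
theorem Exchange.conv {F : E → ℝ} (hF : LipschitzWith 1 F) {μ ν μ' ν' : Measure E} {m m' c c' : ℝ}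
    (h : Exchange F μ ν m c) (h' : Exchange F μ' ν' m' c') :
    Exchange F (Measure.conv μ μ') (Measure.conv ν ν') (m + m') (c + c') := by
  have := h.left.prob
  have := h.right.prob
  have := h'.left.prob
  have := h'.right.prob
  have h1 := h.conv_left hF h'.left
  rw [Measure.conv_comm μ' μ, Measure.conv_comm μ' ν] at h1
  exact h1.trans (h'.conv_left hF h.right)

end Generic

/-! ### Second order expansion of the log-partition function -/

/-- The derivative of the remainder is `(s - 1) ^ 2 / s`, so the mean value inequality between `1`
and `u` applies. The factor `1 + 1 / u` dominates `1 / s` on either side of `1`. -/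
theorem abs_log_sub_taylor_le {u : ℝ} (hu : 0 < u) :
    |Real.log u - (u - 1) + (u - 1) ^ 2 / 2| ≤ |u - 1| ^ 3 * (1 + 1 / u) := by
  have hder : ∀ s ∈ Set.uIcc 1 u, HasDerivWithinAt
      (fun s => Real.log s - (s - 1) + (s - 1) ^ 2 / 2) ((s - 1) ^ 2 / s) (Set.uIcc 1 u) s := by
    intro s hs
    have hs0 : 0 < s := lt_of_lt_of_le (lt_min one_pos hu) hs.1
    have h1 := ((Real.hasDerivAt_log hs0.ne').sub ((hasDerivAt_id s).sub_const 1)).add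
      ((((hasDerivAt_id s).sub_const 1).pow 2).div_const 2)
    have h2 : s⁻¹ - 1 + ((2 : ℕ) : ℝ) * (id s - 1) ^ (2 - 1) * 1 / 2 = (s - 1) ^ 2 / s := by
      norm_num
      field_simp
      ring
    rw [h2] at h1
    exact h1.hasDerivWithinAt
  have hb : ∀ s ∈ Set.uIcc 1 u, ‖(s - 1) ^ 2 / s‖ ≤ |u - 1| ^ 2 * (1 + 1 / u) := by
    intro s hs
    have hs0 : 0 < s := lt_of_lt_of_le (lt_min one_pos hu) hs.1
    rw [Real.norm_of_nonneg (by positivity), div_eq_mul_one_div]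
    have h1 : |s - 1| ≤ |u - 1| := Set.abs_sub_left_of_mem_uIcc hs
    have h2 : 1 / s ≤ 1 + 1 / u := by
      rcases le_total 1 u with h | h
      · rw [Set.uIcc_of_le h] at hs
        have h3 : 1 / s ≤ 1 := by rw [div_le_one hs0]; exact hs.1
        have : 0 < 1 / u := by positivity
        linarith
      · rw [Set.uIcc_of_ge h] at hs
        have := one_div_le_one_div_of_le hu hs.1
        linarith
    rw [← sq_abs]
    gcongr
  have h := (convex_uIcc (1 : ℝ) u).norm_image_sub_le_of_norm_hasDerivWithin_le hder hb
    Set.left_mem_uIcc Set.right_mem_uIcc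
  simp only [Real.log_one, sub_self] at h
  rw [Real.norm_eq_abs, Real.norm_eq_abs] at h
  calc |Real.log u - (u - 1) + (u - 1) ^ 2 / 2|
      = |Real.log u - (u - 1) + (u - 1) ^ 2 / 2 - (0 + 0 ^ 2 / 2)| := by norm_num
    _ ≤ |u - 1| ^ 2 * (1 + 1 / u) * |u - 1| := by simpa using h
    _ = |u - 1| ^ 3 * (1 + 1 / u) := by ring

theorem abs_exp_sub_sum_le (x : ℝ) (n : ℕ) :
    |Real.exp x - ∑ m ∈ Finset.range n, x ^ m / m.factorial| ≤ |x| ^ n * Real.exp |x| := by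
  have h := Complex.norm_exp_sub_sum_le_norm_mul_exp (x : ℂ) n
  have h2 : Complex.exp x - ∑ m ∈ Finset.range n, (x : ℂ) ^ m / m.factorial
      = ((Real.exp x - ∑ m ∈ Finset.range n, x ^ m / m.factorial : ℝ) : ℂ) := by push_cast; rfl
  rw [h2, Complex.norm_real, Complex.norm_real] at h
  simpa using h

theorem abs_pow_mul_exp_le {t y : ℝ} (ht : 0 ≤ t) (ht1 : t ≤ 1) (n : ℕ) :
    |t * y| ^ n * Real.exp |t * y| ≤ t ^ n * (n.factorial * Real.exp (2 * |y|)) := by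
  rw [abs_mul, abs_of_nonneg ht, mul_pow, mul_assoc]
  refine mul_le_mul_of_nonneg_left ?_ (by positivity)
  have h1 := Real.pow_div_factorial_le_exp |y| (abs_nonneg y) n
  rw [div_le_iff₀ (by positivity)] at h1
  have h2 : t * |y| ≤ |y| := mul_le_of_le_one_left (abs_nonneg y) ht1
  calc |y| ^ n * Real.exp (t * |y|) ≤ (Real.exp |y| * n.factorial) * Real.exp |y| := by gcongr
    _ = _ := by rw [two_mul, Real.exp_add]; ring

/-! ### Logarithms of exponential averages against probability weights -/

section Weights

variable {X : Type*}

theorem abs_sum_weights_le {U : Finset X} {p : X → ℝ} (hp : ∀ x ∈ U, 0 ≤ p x) {f g : X → ℝ}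
    (h : ∀ x, |f x| ≤ g x) : |∑ x ∈ U, p x * f x| ≤ ∑ x ∈ U, p x * g x := by
  refine (Finset.abs_sum_le_sum_abs _ _).trans (Finset.sum_le_sum fun x hx => ?_)
  rw [abs_mul, abs_of_nonneg (hp x hx)]
  exact mul_le_mul_of_nonneg_left (h x) (hp x hx)

/-- The second order expansion of the logarithm of an exponential average, with an explicit error
in terms of an exponential moment. -/
theorem abs_log_sum_exp_sub_le {U : Finset X} {p : X → ℝ} (hp : ∀ x ∈ U, 0 ≤ p x)
    (hsum : ∑ x ∈ U, p x = 1) (y : X → ℝ) {t : ℝ} (ht : 0 ≤ t) (ht1 : t ≤ 1) :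
    |Real.log (∑ x ∈ U, p x * Real.exp (t * y x)) - t * ∑ x ∈ U, p x * y x
      - t ^ 2 / 2 * (∑ x ∈ U, p x * y x ^ 2 - (∑ x ∈ U, p x * y x) ^ 2)|
      ≤ 10 * t ^ 3 * ∑ x ∈ U, p x * Real.exp (8 * |y x|) := by
  set B := ∑ x ∈ U, p x * Real.exp (2 * |y x|) with hB
  set u := ∑ x ∈ U, p x * Real.exp (t * y x) with hu
  set a := ∑ x ∈ U, p x * y x with ha
  set q := ∑ x ∈ U, p x * y x ^ 2 with hq
  have hB1 : 1 ≤ B := by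
    rw [← hsum]
    exact Finset.sum_le_sum fun x hx =>
      le_mul_of_one_le_right (hp x hx) (Real.one_le_exp (by positivity))
  have hB4 : B ^ 4 ≤ ∑ x ∈ U, p x * Real.exp (8 * |y x|) := by
    -- All errors below are at most `t ^ 3` times a polynomial in `B ≥ 1` of degree at most `4`. The
    -- power mean inequality turns `B ^ 4` into the exponential moment of order `8 = 4 · 2`, which
    -- is linear in the weights and can later be integrated termwise.
    have h := Real.pow_arith_mean_le_arith_mean_pow U p (fun x => Real.exp (2 * |y x|)) hp hsum
      (fun x _ => (Real.exp_pos _).le) 4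
    refine h.trans (le_of_eq (Finset.sum_congr rfl fun x _ => ?_))
    rw [← Real.exp_nat_mul]
    congr 2
    push_cast
    ring
  obtain ⟨x₀, hx₀, hpx₀⟩ : ∃ x ∈ U, 0 < p x := by
    by_contra! hcon
    have : ∑ x ∈ U, p x ≤ 0 := Finset.sum_nonpos hcon
    linarith
  have hu0 : 0 < u := Finset.sum_pos' (fun x hx => mul_nonneg (hp x hx) (Real.exp_pos _).le)
    ⟨x₀, hx₀, by positivity⟩
  -- Cauchy–Schwarz for `exp (t y / 2)` and `exp (-t y / 2)` gives `1 ≤ u · ∑ p exp (-t y)`, and the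
  -- last factor is at most `B` because `t ≤ 1`.
  have hinv : 1 / u ≤ B := by
    have hcs := Finset.sum_mul_sq_le_sq_mul_sq U (fun x => √(p x) * Real.exp (t * y x / 2))
      (fun x => √(p x) * Real.exp (-(t * y x / 2)))
    have e1 : ∑ x ∈ U, (√(p x) * Real.exp (t * y x / 2)) * (√(p x) * Real.exp (-(t * y x / 2)))
        = 1 := by
      rw [← hsum]
      refine Finset.sum_congr rfl fun x hx => ?_
      rw [mul_mul_mul_comm, Real.mul_self_sqrt (hp x hx), ← Real.exp_add]
      simp
    have e2 : ∑ x ∈ U, (√(p x) * Real.exp (t * y x / 2)) ^ 2 = u := by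
      refine Finset.sum_congr rfl fun x hx => ?_
      rw [mul_pow, Real.sq_sqrt (hp x hx), sq, ← Real.exp_add]
      ring_nf
    have e3 : ∑ x ∈ U, (√(p x) * Real.exp (-(t * y x / 2))) ^ 2 ≤ B := by
      refine Finset.sum_le_sum fun x hx => ?_
      rw [mul_pow, Real.sq_sqrt (hp x hx), sq, ← Real.exp_add]
      refine mul_le_mul_of_nonneg_left (Real.exp_le_exp.2 ?_) (hp x hx)
      have h1 : -(t * y x) ≤ t * |y x| := by
        rw [← mul_neg]; exact mul_le_mul_of_nonneg_left (neg_le_abs _) ht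
      nlinarith [abs_nonneg (y x)]
    rw [e1, e2] at hcs
    rw [div_le_iff₀ hu0]
    nlinarith
  have d3 : |(u - 1) - t * a - t ^ 2 / 2 * q| ≤ 6 * t ^ 3 * B := by
    have h := abs_sum_weights_le (f := fun x => Real.exp (t * y x)
        - ∑ m ∈ Finset.range 3, (t * y x) ^ m / m.factorial)
      (g := fun x => 6 * t ^ 3 * Real.exp (2 * |y x|)) hp fun x =>
        (abs_exp_sub_sum_le _ 3).trans ((abs_pow_mul_exp_le ht ht1 3).trans
          (by norm_num [Nat.factorial]; linarith))
    convert h using 2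
    · rw [hu, ha, hq, ← hsum, Finset.mul_sum, Finset.mul_sum, ← Finset.sum_sub_distrib,
        ← Finset.sum_sub_distrib, ← Finset.sum_sub_distrib]
      refine Finset.sum_congr rfl fun x _ => ?_
      simp [Finset.sum_range_succ, Nat.factorial]
      ring
    · rw [hB, Finset.mul_sum]
      exact Finset.sum_congr rfl fun x _ => by ring
  have d2 : |(u - 1) - t * a| ≤ 2 * t ^ 2 * B := by
    have h := abs_sum_weights_le (f := fun x => Real.exp (t * y x)
        - ∑ m ∈ Finset.range 2, (t * y x) ^ m / m.factorial)
      (g := fun x => 2 * t ^ 2 * Real.exp (2 * |y x|)) hp fun x =>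
        (abs_exp_sub_sum_le _ 2).trans ((abs_pow_mul_exp_le ht ht1 2).trans
          (by norm_num [Nat.factorial]; linarith))
    convert h using 2
    · rw [hu, ha, ← hsum, Finset.mul_sum, ← Finset.sum_sub_distrib,
        ← Finset.sum_sub_distrib]
      refine Finset.sum_congr rfl fun x _ => ?_
      simp [Finset.sum_range_succ, Nat.factorial]
      ring
    · rw [hB, Finset.mul_sum]
      exact Finset.sum_congr rfl fun x _ => by ring
  have d1 : |u - 1| ≤ t * B := by
    have h := abs_sum_weights_le (f := fun x => Real.exp (t * y x)
        - ∑ m ∈ Finset.range 1, (t * y x) ^ m / m.factorial)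
      (g := fun x => t * Real.exp (2 * |y x|)) hp fun x =>
        (abs_exp_sub_sum_le _ 1).trans ((abs_pow_mul_exp_le ht ht1 1).trans
          (by norm_num [Nat.factorial]))
    convert h using 2
    · rw [hu, ← hsum, ← Finset.sum_sub_distrib]
      refine Finset.sum_congr rfl fun x _ => ?_
      simp [Nat.factorial]
      ring
    · rw [hB, Finset.mul_sum]
      exact Finset.sum_congr rfl fun x _ => by ring
  have d0 : |t * a| ≤ t * B := by
    rw [abs_mul, abs_of_nonneg ht]
    refine mul_le_mul_of_nonneg_left (abs_sum_weights_le hp fun x => ?_) ht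
    have := Real.add_one_le_exp (2 * |y x|)
    linarith [abs_nonneg (y x)]
  have hlog := abs_log_sub_taylor_le hu0
  have hlog' : |u - 1| ^ 3 * (1 + 1 / u) ≤ (t * B) ^ 3 * (2 * B) := by
    gcongr
    linarith
  have hsq : |(u - 1) ^ 2 / 2 - (t * a) ^ 2 / 2| ≤ 2 * t ^ 3 * B ^ 2 := by
    have e : (u - 1) ^ 2 / 2 - (t * a) ^ 2 / 2 = ((u - 1) - t * a) * ((u - 1) + t * a) / 2 := by
      ring
    rw [e, abs_div, abs_mul, abs_two]
    have := abs_add_le (u - 1) (t * a)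
    have h2 : |(u - 1) - t * a| * |(u - 1) + t * a| ≤ (2 * t ^ 2 * B) * (2 * (t * B)) := by
      gcongr
      linarith
    linarith
  -- Three errors remain: the Taylor remainder of the logarithm, that of `u`, and the replacement of
  -- `u - 1` by `t a` in the quadratic term. They contribute `2`, `6` and `2` to the constant `10`.
  have e : Real.log u - t * a - t ^ 2 / 2 * (q - a ^ 2)
      = (Real.log u - (u - 1) + (u - 1) ^ 2 / 2) + ((u - 1) - t * a - t ^ 2 / 2 * q)
        - ((u - 1) ^ 2 / 2 - (t * a) ^ 2 / 2) := by ring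
  have hB2 : B ≤ B ^ 4 := le_self_pow₀ hB1 (by norm_num)
  have hB3 : B ^ 2 ≤ B ^ 4 := pow_le_pow_right₀ hB1 (by norm_num)
  have ht3 : 0 ≤ t ^ 3 := by positivity
  calc _ ≤ (t * B) ^ 3 * (2 * B) + 6 * t ^ 3 * B + 2 * t ^ 3 * B ^ 2 := by
        rw [e]
        refine (abs_sub _ _).trans (add_le_add ((abs_add_le _ _).trans (add_le_add ?_ d3)) hsq)
        exact hlog.trans hlog'
    _ = t ^ 3 * (2 * B ^ 4 + 6 * B + 2 * B ^ 2) := by ring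
    _ ≤ t ^ 3 * (10 * B ^ 4) := by gcongr; linarith
    _ = 10 * t ^ 3 * B ^ 4 := by ring
    _ ≤ _ := by gcongr

end Weights

/-! ### The log-partition function and its Gibbs averages -/

section LogSumExp

variable {X : Type*} [Fintype X]

/-- The logarithm of the partition function `∑_{x ∈ U} exp (w x)`. -/
noncomputable def logSumExp (U : Finset X) (w : X → ℝ) : ℝ :=
  Real.log (∑ x ∈ U, Real.exp (w x))

/-- The Gibbs weights of `w` on `U`. -/
noncomputable def gibbs (U : Finset X) (w : X → ℝ) (x : X) : ℝ :=
  Real.exp (w x) / ∑ z ∈ U, Real.exp (w z)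

variable {U : Finset X} (hU : U.Nonempty)

include hU

theorem sum_exp_pos (w : X → ℝ) : 0 < ∑ x ∈ U, Real.exp (w x) :=
  Finset.sum_pos (fun _ _ => Real.exp_pos _) hU

theorem lipschitz_logSumExp : LipschitzWith 1 (logSumExp U) := by
  have key : ∀ w v : X → ℝ, logSumExp U w ≤ logSumExp U v + ‖w - v‖ := by
    intro w v
    unfold logSumExp
    rw [← Real.log_exp ‖w - v‖, ← Real.log_mul (sum_exp_pos hU v).ne' (Real.exp_pos _).ne']
    refine Real.log_le_log (sum_exp_pos hU w) ?_
    rw [Finset.sum_mul]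
    refine Finset.sum_le_sum fun x _ => ?_
    rw [← Real.exp_add, Real.exp_le_exp]
    have h : |w x - v x| ≤ ‖w - v‖ := norm_le_pi_norm (w - v) x
    linarith [le_abs_self (w x - v x)]
  refine LipschitzWith.of_dist_le_mul fun w v => ?_
  rw [Real.dist_eq, dist_eq_norm, NNReal.coe_one, one_mul, abs_le]
  have h1 := key w v
  have h2 := key v w
  rw [norm_sub_rev] at h2
  constructor <;> linarith

theorem gibbs_nonneg (w : X → ℝ) (x : X) : 0 ≤ gibbs U w x :=
  div_nonneg (Real.exp_pos _).le (sum_exp_pos hU w).le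

theorem sum_gibbs (w : X → ℝ) : ∑ x ∈ U, gibbs U w x = 1 := by
  unfold gibbs
  rw [← Finset.sum_div, div_self (sum_exp_pos hU w).ne']

/-- Factoring out the partition function of `w` makes the increment the logarithm of a Gibbs
average, to which the expansion for probability weights applies. -/
theorem logSumExp_add (w v : X → ℝ) :
    logSumExp U (w + v)
      = logSumExp U w + Real.log (∑ x ∈ U, gibbs U w x * Real.exp (v x)) := by
  unfold logSumExp
  rw [← Real.log_mul (sum_exp_pos hU w).ne']
  · congr 1
    rw [Finset.mul_sum]
    refine Finset.sum_congr rfl fun x _ => ?_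
    unfold gibbs
    have := (sum_exp_pos hU w).ne'
    rw [Pi.add_apply, Real.exp_add]
    field_simp
  · refine (Finset.sum_pos (fun x _ => ?_) hU).ne'
    exact mul_pos (div_pos (Real.exp_pos _) (sum_exp_pos hU w)) (Real.exp_pos _)

omit hU

theorem abs_apply_le_exp_norm (w : X → ℝ) (x : X) : |w x| ≤ 1 * Real.exp (1 * ‖w‖) := by
  have h1 : |w x| ≤ ‖w‖ := norm_le_pi_norm w x
  have h2 := Real.add_one_le_exp ‖w‖
  rw [one_mul, one_mul]
  linarith

theorem abs_apply_mul_apply_le_exp_norm (w : X → ℝ) (x z : X) :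
    |w x * w z| ≤ 1 * Real.exp (2 * ‖w‖) := by
  have h1 := abs_apply_le_exp_norm w x
  have h2 := abs_apply_le_exp_norm w z
  rw [one_mul, one_mul] at h1 h2
  rw [one_mul, two_mul, Real.exp_add, abs_mul]
  exact mul_le_mul h1 h2 (abs_nonneg _) (Real.exp_pos _).le

theorem abs_exp_mul_apply_le_exp_norm (c : ℝ) (w : X → ℝ) (x : X) :
    |Real.exp (c * w x)| ≤ 1 * Real.exp (|c| * ‖w‖) := by
  rw [one_mul, Real.abs_exp, Real.exp_le_exp]
  calc c * w x ≤ |c| * |w x| := by rw [← abs_mul]; exact le_abs_self _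
    _ ≤ |c| * ‖w‖ := by gcongr; exact norm_le_pi_norm w x

theorem ExpMoments.integrable_apply {μ : Measure (X → ℝ)} (hμ : ExpMoments μ) (x : X) :
    Integrable (fun y : X → ℝ => y x) μ :=
  hμ.integrable_of_le (continuous_apply x).aestronglyMeasurable 1 1 fun w =>
    abs_apply_le_exp_norm w x

theorem ExpMoments.integrable_apply_mul_apply {μ : Measure (X → ℝ)} (hμ : ExpMoments μ)
    (x z : X) : Integrable (fun y : X → ℝ => y x * y z) μ :=
  hμ.integrable_of_le (Continuous.aestronglyMeasurable (by fun_prop)) 1 2 fun w => abs_apply_mul_apply_le_exp_norm w x z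

theorem ExpMoments.integrable_exp_mul_apply {μ : Measure (X → ℝ)} (hμ : ExpMoments μ) (c : ℝ)
    (x : X) : Integrable (fun y : X → ℝ => Real.exp (c * y x)) μ :=
  hμ.integrable_of_le (Continuous.aestronglyMeasurable (by fun_prop)) 1 |c| fun w => abs_exp_mul_apply_le_exp_norm c w x

theorem ExpMoments.integrable_exp_abs {μ : Measure (X → ℝ)} (hμ : ExpMoments μ) {c : ℝ}
    (hc : 0 ≤ c) (x : X) : Integrable (fun y : X → ℝ => Real.exp (c * |y x|)) μ :=
  hμ.integrable_of_le
    (by fun_prop : Continuous fun y : X → ℝ => Real.exp (c * |y x|)).aestronglyMeasurable 1 c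
    fun w => by
      have h1 : |w x| ≤ ‖w‖ := norm_le_pi_norm w x
      rw [one_mul, Real.abs_exp]
      gcongr

include hU

/-- The second order expansion of the effect of an independent random field on the expected
log-partition function. -/
theorem abs_integral_logSumExp_sub_le {μ : Measure (X → ℝ)} (hμ : ExpMoments μ) {K : ℝ}
    (hK : ∀ x, ∫ y, Real.exp (8 * |y x|) ∂μ ≤ K) {t : ℝ} (ht : 0 ≤ t) (ht1 : t ≤ 1)
    (w : X → ℝ) :
    |∫ y, logSumExp U (w + t • y) ∂μ - logSumExp U w - t * ∑ x ∈ U, gibbs U w x * ∫ y, y x ∂μ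
      - t ^ 2 / 2 * (∑ x ∈ U, gibbs U w x * ∫ y, y x * y x ∂μ
        - ∑ x ∈ U, ∑ z ∈ U, gibbs U w x * gibbs U w z * ∫ y, y x * y z ∂μ)|
      ≤ 10 * t ^ 3 * K := by
  have := hμ.prob
  set p := gibbs U w with hp
  have hl : Integrable (fun y => logSumExp U (w + t • y)) μ := by
    refine hμ.integrable_lipschitz (LipschitzWith.of_dist_le_mul fun a b => ?_)
    refine ((lipschitz_logSumExp hU).dist_le_mul _ _).trans ?_
    rw [dist_add_left, dist_smul₀, Real.norm_of_nonneg ht, NNReal.coe_one, one_mul, one_mul]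
    exact mul_le_of_le_one_left dist_nonneg ht1
  have i1 : Integrable (fun y : X → ℝ => ∑ x ∈ U, p x * y x) μ :=
    integrable_finsetSum _ fun x _ => (hμ.integrable_apply x).const_mul _
  have i2 : Integrable (fun y : X → ℝ => ∑ x ∈ U, p x * (y x * y x)) μ :=
    integrable_finsetSum _ fun x _ => (hμ.integrable_apply_mul_apply x x).const_mul _
  have i3' : ∀ x ∈ U, Integrable (fun y : X → ℝ => ∑ z ∈ U, p x * p z * (y x * y z)) μ :=
    fun x _ => integrable_finsetSum _ fun z _ => (hμ.integrable_apply_mul_apply x z).const_mul _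
  have i3 : Integrable (fun y : X → ℝ => ∑ x ∈ U, ∑ z ∈ U, p x * p z * (y x * y z)) μ :=
    integrable_finsetSum _ i3'
  have i4 : Integrable (fun y : X → ℝ => ∑ x ∈ U, p x * Real.exp (8 * |y x|)) μ :=
    integrable_finsetSum _ fun x _ => (hμ.integrable_exp_abs (by norm_num) x).const_mul _
  have e1 : ∫ y, ∑ x ∈ U, p x * y x ∂μ = ∑ x ∈ U, p x * ∫ y, y x ∂μ := by
    rw [integral_finsetSum _ fun x _ => (hμ.integrable_apply x).const_mul _]
    simp_rw [integral_const_mul]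
  have e2 : ∫ y, ∑ x ∈ U, p x * (y x * y x) ∂μ = ∑ x ∈ U, p x * ∫ y, y x * y x ∂μ := by
    rw [integral_finsetSum _ fun x _ => (hμ.integrable_apply_mul_apply x x).const_mul _]
    simp_rw [integral_const_mul]
  have e3 : ∫ y, ∑ x ∈ U, ∑ z ∈ U, p x * p z * (y x * y z) ∂μ
      = ∑ x ∈ U, ∑ z ∈ U, p x * p z * ∫ y, y x * y z ∂μ := by
    rw [integral_finsetSum _ i3']
    refine Finset.sum_congr rfl fun x _ => ?_
    rw [integral_finsetSum _ fun z _ => (hμ.integrable_apply_mul_apply x z).const_mul _]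
    simp_rw [integral_const_mul]
  rw [← e1, ← e2, ← e3]
  have j1 : Integrable (fun y => logSumExp U (w + t • y) - logSumExp U w) μ :=
    hl.sub (integrable_const _)
  have j2 : Integrable (fun y : X → ℝ => logSumExp U (w + t • y) - logSumExp U w
      - t * ∑ x ∈ U, p x * y x) μ := j1.sub (i1.const_mul t)
  have j3 : Integrable (fun y : X → ℝ => ∑ x ∈ U, p x * (y x * y x)
      - ∑ x ∈ U, ∑ z ∈ U, p x * p z * (y x * y z)) μ := i2.sub i3
  have e4 : ∫ y, logSumExp U (w + t • y) ∂μ - logSumExp U w - t * ∫ y, ∑ x ∈ U, p x * y x ∂μ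
      - t ^ 2 / 2 * (∫ y, ∑ x ∈ U, p x * (y x * y x) ∂μ
        - ∫ y, ∑ x ∈ U, ∑ z ∈ U, p x * p z * (y x * y z) ∂μ)
      = ∫ y, (logSumExp U (w + t • y) - logSumExp U w - t * ∑ x ∈ U, p x * y x
        - t ^ 2 / 2 * (∑ x ∈ U, p x * (y x * y x)
          - ∑ x ∈ U, ∑ z ∈ U, p x * p z * (y x * y z))) ∂μ := by
    rw [integral_sub j2 (j3.const_mul _), integral_sub j1 (i1.const_mul t),
      integral_sub hl (integrable_const _), integral_const_mul, integral_const_mul,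
      integral_sub i2 i3]
    simp
  rw [e4]
  refine (abs_integral_le_integral_abs).trans ?_
  calc _ ≤ ∫ y, 10 * t ^ 3 * ∑ x ∈ U, p x * Real.exp (8 * |y x|) ∂μ := by
        refine integral_mono_of_nonneg (ae_of_all _ fun y => abs_nonneg _) (i4.const_mul _)
          (ae_of_all _ fun y => ?_)
        have h := abs_log_sum_exp_sub_le (fun x _ => gibbs_nonneg hU w x) (sum_gibbs hU w) y ht ht1
        rw [← hp] at h
        refine le_of_eq_of_le (congrArg abs ?_) h
        rw [logSumExp_add hU]
        have e5 : ∑ x ∈ U, ∑ z ∈ U, p x * p z * (y x * y z) = (∑ x ∈ U, p x * y x) ^ 2 := by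
          rw [sq, Finset.sum_mul_sum]
          exact Finset.sum_congr rfl fun x _ => Finset.sum_congr rfl fun z _ => by ring
        rw [e5]
        simp only [Pi.smul_apply, smul_eq_mul, ← sq]
        ring
    _ ≤ 10 * t ^ 3 * K := by
        rw [integral_const_mul, integral_finsetSum _ fun x _ =>
          (hμ.integrable_exp_abs (by norm_num) x).const_mul _]
        simp_rw [integral_const_mul]
        gcongr
        calc ∑ x ∈ U, p x * ∫ y, Real.exp (8 * |y x|) ∂μ ≤ ∑ x ∈ U, p x * K :=
              Finset.sum_le_sum fun x _ => mul_le_mul_of_nonneg_left (hK x) (gibbs_nonneg hU w x)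
          _ = K := by rw [← Finset.sum_mul, sum_gibbs hU w, one_mul]

omit hU in
theorem ExpMoments.map_smul {μ : Measure (X → ℝ)} (hμ : ExpMoments μ) (t : ℝ) :
    ExpMoments (μ.map (fun y => t • y)) := by
  have := hμ.prob
  refine expMoments_map (by fun_prop) fun c => ?_
  simpa [norm_smul, mul_assoc] using hμ.integrable (c * |t|)

/-- Two random fields, with constant mean `m` and centred, whose covariances agree up to a constant,
can be exchanged at scale `t` up to an error of order `t ^ 3`. -/
theorem exchange_of_covariance {μ ν : Measure (X → ℝ)} (hμ : ExpMoments μ) (hν : ExpMoments ν)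
    {m κ K : ℝ} (hm : ∀ x, ∫ y, y x ∂μ = m) (hm' : ∀ x, ∫ y, y x ∂ν = 0)
    (hcov : ∀ x z, ∫ y, y x * y z ∂μ = ∫ y, y x * y z ∂ν + κ)
    (hK : ∀ x, ∫ y, Real.exp (8 * |y x|) ∂μ ≤ K) (hK' : ∀ x, ∫ y, Real.exp (8 * |y x|) ∂ν ≤ K)
    {t : ℝ} (ht : 0 ≤ t) (ht1 : t ≤ 1) :
    Exchange (logSumExp U) (μ.map fun y => t • y) (ν.map fun y => t • y) (t * m)
      (20 * K * t ^ 3) := by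
  have hs := sum_gibbs hU
  refine ⟨hμ.map_smul t, hν.map_smul t, fun w => ?_⟩
  have hc := (lipschitz_comp_const_add (lipschitz_logSumExp hU) w).continuous
  rw [integral_map (by fun_prop) hc.aestronglyMeasurable,
    integral_map (by fun_prop) hc.aestronglyMeasurable]
  have h1 := abs_integral_logSumExp_sub_le hU hμ hK ht ht1 w
  have h2 := abs_integral_logSumExp_sub_le hU hν hK' ht ht1 w
  -- Since the Gibbs weights sum to `1`, the constant `κ` appears once in the diagonal sum and once
  -- in the double sum, and cancels. The two expansions then differ by `t * m` and two errors of `10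
  -- * K * t ^ 3`.
  simp only [hm, hm', hcov, mul_add, Finset.sum_add_distrib, ← Finset.sum_mul, ← Finset.mul_sum,
    hs w, mul_zero, Finset.sum_const_zero] at h1 h2
  rw [abs_le] at *
  constructor <;> linarith [h1.1, h1.2, h2.1, h2.2]

/-- A centred random field changes the expected log-partition function by a bounded amount. -/
theorem exchange_dirac_zero {ν : Measure (X → ℝ)} (hν : ExpMoments ν) {K : ℝ}
    (hm : ∀ x, ∫ y, y x ∂ν = 0) (hK : ∀ x, ∫ y, Real.exp |y x| ∂ν ≤ K) :
    Exchange (logSumExp U) (Measure.dirac 0) ν 0 K := by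
  have := hν.prob
  refine ⟨expMoments_dirac 0, hν, fun w => ?_⟩
  have hl := lipschitz_comp_const_add (lipschitz_logSumExp hU) w
  rw [integral_dirac, add_zero, sub_zero]
  have i1 : Integrable (fun y : X → ℝ => ∑ x ∈ U, gibbs U w x * y x) ν :=
    integrable_finsetSum _ fun x _ => (hν.integrable_apply x).const_mul _
  have hexp : ∀ x, Integrable (fun y : X → ℝ => Real.exp |y x|) ν := fun x => by
    simpa using hν.integrable_exp_abs (c := 1) (by norm_num) x
  have i2 : Integrable (fun y : X → ℝ => ∑ x ∈ U, gibbs U w x * Real.exp |y x|) ν :=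
    integrable_finsetSum _ fun x _ => (hexp x).const_mul _
  -- Jensen's inequality for the Gibbs average of `exp`, together with centring, shows that the
  -- field cannot decrease the expectation.
  have hlow : logSumExp U w ≤ ∫ y, logSumExp U (w + y) ∂ν := by
    calc logSumExp U w = ∫ y, (logSumExp U w + ∑ x ∈ U, gibbs U w x * y x) ∂ν := by
          rw [integral_add (integrable_const _) i1, integral_finsetSum _ fun x _ =>
            (hν.integrable_apply x).const_mul _]
          simp_rw [integral_const_mul, hm]
          simp
      _ ≤ _ := by
          refine integral_mono ((integrable_const _).add i1) (hν.integrable_lipschitz hl)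
            fun y => ?_
          simp only
          rw [logSumExp_add hU]
          gcongr
          rw [Real.le_log_iff_exp_le]
          · exact convexOn_exp.map_sum_le (fun x _ => gibbs_nonneg hU w x) (sum_gibbs hU w)
              (fun x _ => Set.mem_univ _)
          · exact Finset.sum_pos (fun x _ =>
              mul_pos (div_pos (Real.exp_pos _) (sum_exp_pos hU w)) (Real.exp_pos _)) hU
  -- The upper bound uses only `log u ≤ u`.
  have hup : ∫ y, logSumExp U (w + y) ∂ν ≤ logSumExp U w + K := by
    calc _ ≤ ∫ y, (logSumExp U w + ∑ x ∈ U, gibbs U w x * Real.exp |y x|) ∂ν := by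
          refine integral_mono (hν.integrable_lipschitz hl) ((integrable_const _).add i2)
            fun y => ?_
          simp only
          rw [logSumExp_add hU]
          gcongr
          refine (Real.log_le_self (Finset.sum_nonneg fun x _ =>
            mul_nonneg (gibbs_nonneg hU w x) (Real.exp_pos _).le)).trans
            (Finset.sum_le_sum fun x _ => mul_le_mul_of_nonneg_left ?_ (gibbs_nonneg hU w x))
          exact Real.exp_le_exp.2 (le_abs_self _)
      _ = logSumExp U w + ∑ x ∈ U, gibbs U w x * ∫ y, Real.exp |y x| ∂ν := by
          rw [integral_add (integrable_const _) i2, integral_finsetSum _ fun x _ =>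
            (hexp x).const_mul _]
          simp_rw [integral_const_mul]
          simp
      _ ≤ logSumExp U w + ∑ x ∈ U, gibbs U w x * K := by
          gcongr with x
          · exact gibbs_nonneg hU w x
          · exact hK x
      _ = _ := by rw [← Finset.sum_mul, sum_gibbs hU w, one_mul]
  rw [abs_le]
  constructor <;> linarith

end LogSumExp

/-! ### Moments of a random clause -/

namespace CSPGlass

instance : MeasurableSingletonClass Spin := by
  refine ⟨fun s => ⟨{(s : ℤ)}, MeasurableSet.singleton _, ?_⟩⟩
  ext u
  simp [Units.ext_iff]

theorem Spin.toReal_one : Spin.toReal 1 = 1 := by simp [Spin.toReal]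

theorem Spin.toReal_mul (s u : Spin) : (s * u).toReal = s.toReal * u.toReal := by
  simp [Spin.toReal]

theorem Spin.abs_toReal (s : Spin) : |s.toReal| = 1 := by
  rcases Int.units_eq_one_or s with h | h <;> simp [h, Spin.toReal]

/-- Expanded over subsets, this is the orthogonality of characters: the sum of all characters is
concentrated at the identity. -/
theorem prod_one_add_toReal {k : ℕ} (u : Config k) :
    ∏ a, (1 + (u a).toReal) = if u = 1 then 2 ^ k else 0 := by
  split_ifs with h
  · simp [h, Spin.toReal_one]
    norm_num
  · obtain ⟨a, ha⟩ := Function.ne_iff.1 h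
    refine Finset.prod_eq_zero (Finset.mem_univ a) ?_
    rcases Int.units_eq_one_or (u a) with h1 | h1
    · exact absurd h1 ha
    · simp [h1, Spin.toReal]

/-- The noise correlation of `f` in terms of its Fourier coefficients. -/
theorem sum_sq_fourierCoeff_mul_prod {k : ℕ} (f : Predicate k) (c : Config k) :
    ∑ T : Finset (Fin k), fourierCoeff f T ^ 2 * ∏ a ∈ T, (c a).toReal
      = (1 / 2 ^ k) * ∑ σ : Config k, (f σ : ℝ) * (f (σ * c) : ℝ) := by
  have h1 : ∀ T : Finset (Fin k), fourierCoeff f T ^ 2 * ∏ a ∈ T, (c a).toReal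
      = (1 / 2 ^ k) * ((1 / 2 ^ k) * ∑ σ : Config k, ∑ τ : Config k,
        (f σ : ℝ) * (f τ : ℝ) * ∏ a ∈ T, ((σ * τ * c) a).toReal) := by
    intro T
    unfold fourierCoeff
    have : ∑ σ : Config k, ∑ τ : Config k,
        (f σ : ℝ) * (f τ : ℝ) * ∏ a ∈ T, ((σ * τ * c) a).toReal
        = (∑ σ : Config k, (f σ : ℝ) * ∏ i ∈ T, (σ i).toReal)
          * (∑ τ : Config k, (f τ : ℝ) * ∏ i ∈ T, (τ i).toReal) * ∏ a ∈ T, (c a).toReal := by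
      rw [Finset.sum_mul_sum, Finset.sum_mul]
      refine Finset.sum_congr rfl fun σ _ => ?_
      rw [Finset.sum_mul]
      refine Finset.sum_congr rfl fun τ _ => ?_
      simp only [Pi.mul_apply, Spin.toReal_mul, Finset.prod_mul_distrib]
      ring
    rw [this]
    ring
  rw [Finset.sum_congr rfl fun T _ => h1 T, ← Finset.mul_sum, ← Finset.mul_sum]
  congr 1
  rw [Finset.sum_comm, Finset.mul_sum]
  refine Finset.sum_congr rfl fun σ _ => ?_
  rw [Finset.sum_comm]
  have h2 : ∀ τ : Config k, ∑ T : Finset (Fin k),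
      (f σ : ℝ) * (f τ : ℝ) * ∏ a ∈ T, ((σ * τ * c) a).toReal
      = if τ = σ * c then (f σ : ℝ) * (f τ : ℝ) * 2 ^ k else 0 := by
    intro τ
    rw [← Finset.mul_sum, ← Finset.powerset_univ, ← Finset.prod_one_add, prod_one_add_toReal]
    have h3 : σ * τ * c = 1 ↔ τ = σ * c := by
      have hs : ∀ u : Config k, u * u = 1 := fun u => by ext a; simp
      constructor
      · intro h
        calc τ = (σ * σ) * τ * (c * c) := by rw [hs, hs, one_mul, mul_one]
          _ = σ * (σ * τ * c) * c := by simp only [mul_assoc]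
          _ = σ * c := by rw [h, mul_one]
      · rintro rfl
        rw [← mul_assoc, hs, one_mul, hs]
    simp only [h3]
    split_ifs <;> simp
  rw [Finset.sum_congr rfl fun τ _ => h2 τ]
  simp
  field_simp

theorem integral_uniformOn_univ {Ω : Type*} [Fintype Ω] [Nonempty Ω] [MeasurableSpace Ω]
    [MeasurableSingletonClass Ω] (f : Ω → ℝ) :
    ∫ x, f x ∂(uniformOn (Set.univ : Set Ω)) = (1 / (Fintype.card Ω : ℝ)) * ∑ x, f x := by
  rw [integral_fintype (Integrable.of_finite), Finset.mul_sum]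
  refine Finset.sum_congr rfl fun x _ => ?_
  rw [measureReal_def, uniformOn_univ]
  simp

theorem pi_uniformOn_univ {ι Ω : Type*} [Fintype ι] [Finite Ω] [MeasurableSpace Ω]
    [MeasurableSingletonClass Ω] :
    (Measure.pi fun _ : ι => uniformOn (Set.univ : Set Ω)) = uniformOn Set.univ := by
  rw [← uniformOn_pi, Set.pi_univ]

instance {k n : ℕ} [NeZero n] (Λ : Measure (Predicate k)) [IsProbabilityMeasure Λ] :
    IsProbabilityMeasure (clauseLaw Λ n) := by
  unfold clauseLaw
  infer_instance

/-- The evaluation `(f, τ) ↦ f τ` is jointly measurable because `τ` ranges over a countable set,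
which reduces the claim to each fixed `τ`. -/
theorem measurable_value {k n : ℕ} (σ : Config n) :
    Measurable (fun e : Clause k n => e.value σ) := by
  have h1 : Measurable (fun z : Predicate k × Config k => (z.1 z.2 : ℝ)) :=
    measurable_from_prod_countable_left fun τ =>
      measurable_subtype_coe.comp (measurable_pi_apply τ)
  have h2 : Measurable (fun p : (Fin k → Fin n) × Config k => fun a => p.2 a * σ (p.1 a)) :=
    measurable_of_countable _
  have h3 : Measurable (fun e : Clause k n => (e.1, e.2.2)) := by fun_prop
  exact h1.comp ((measurable_fst.comp measurable_snd).prodMk (h2.comp h3))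

theorem abs_value_le {k n : ℕ} (e : Clause k n) (σ : Config n) : |e.value σ| ≤ 1 :=
  abs_le.2 (e.2.1 _).2

theorem measurable_fourierCoeff {k : ℕ} (T : Finset (Fin k)) :
    Measurable (fun f : Predicate k => fourierCoeff f T) := by
  unfold fourierCoeff
  refine (Finset.measurable_sum _ fun σ _ => ?_).const_mul _
  exact (measurable_subtype_coe.comp (measurable_pi_apply σ)).mul_const _

theorem abs_fourierCoeff_le {k : ℕ} (f : Predicate k) (T : Finset (Fin k)) :
    |fourierCoeff f T| ≤ 1 := by
  unfold fourierCoeff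
  rw [abs_mul, abs_of_nonneg (by positivity)]
  have h : |∑ σ : Config k, (f σ : ℝ) * ∏ i ∈ T, (σ i).toReal| ≤ 2 ^ k := by
    refine (Finset.abs_sum_le_sum_abs _ _).trans ?_
    calc _ ≤ ∑ _σ : Config k, (1 : ℝ) := by
          refine Finset.sum_le_sum fun σ _ => ?_
          rw [abs_mul, Finset.abs_prod, Finset.prod_congr rfl fun i _ => Spin.abs_toReal (σ i)]
          simpa using abs_le.2 (f σ).2
      _ = 2 ^ k := by simp
  rw [div_mul_eq_mul_div, one_mul, div_le_one (by positivity)]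
  exact h

theorem integrable_sq_fourierCoeff {k : ℕ} (Λ : Measure (Predicate k)) [IsProbabilityMeasure Λ]
    (T : Finset (Fin k)) : Integrable (fun f => fourierCoeff f T ^ 2) Λ :=
  Integrable.of_bound (C := 1) ((measurable_fourierCoeff T).pow_const 2).aestronglyMeasurable
    (ae_of_all _ fun f => by
      rw [Real.norm_eq_abs, abs_pow]
      exact pow_le_one₀ (abs_nonneg _) (abs_fourierCoeff_le f T))

variable {k n : ℕ} [NeZero n] (Λ : Measure (Predicate k)) [IsProbabilityMeasure Λ]

theorem integral_clauseLaw {F : Clause k n → ℝ} (hF : Measurable F) (B : ℝ) (hB : ∀ e, |F e| ≤ B) :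
    ∫ e, F e ∂(clauseLaw Λ n) = (1 / (n : ℝ) ^ k) * ∑ i : Fin k → Fin n,
      ∫ f, (1 / 2 ^ k) * ∑ ε : Config k, F (i, f, ε) ∂Λ := by
  unfold clauseLaw
  rw [integral_prod _ (Integrable.of_bound hF.aestronglyMeasurable B (ae_of_all _ hB)),
    pi_uniformOn_univ, integral_uniformOn_univ]
  have hcard : (Fintype.card (Fin k → Fin n) : ℝ) = (n : ℝ) ^ k := by simp
  rw [hcard]
  congr 1
  refine Finset.sum_congr rfl fun i _ => ?_
  have hi : Measurable (fun z : Predicate k × Config k => F (i, z)) :=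
    hF.comp measurable_prodMk_left
  rw [integral_prod _ (Integrable.of_bound hi.aestronglyMeasurable B
    (ae_of_all _ fun z => hB _)), pi_uniformOn_univ]
  refine integral_congr_ae (ae_of_all _ fun f => ?_)
  simp only
  rw [integral_uniformOn_univ]
  simp

/-- For fixed indices, multiplication by the spins `σ (i a)` permutes the sign vectors, so the
predicate is evaluated at a uniform point whatever `σ` is. -/
theorem integral_value (σ : Config n) :
    ∫ e, Clause.value e σ ∂(clauseLaw Λ n) = meanValue Λ := by
  have hn : (n : ℝ) ≠ 0 := NeZero.ne _
  rw [integral_clauseLaw Λ (measurable_value σ) 1 (fun e => abs_value_le e σ)]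
  have h : ∀ i : Fin k → Fin n, ∫ f, (1 / 2 ^ k) * ∑ ε : Config k, Clause.value (i, f, ε) σ ∂Λ
      = meanValue Λ := by
    intro i
    unfold meanValue fourierCoeff
    refine integral_congr_ae (ae_of_all _ fun f => ?_)
    simp only [Finset.prod_empty, mul_one]
    congr 1
    exact Equiv.sum_comp (Equiv.mulRight (fun a => σ (i a) : Config k)) (fun τ => (f τ : ℝ))
  rw [Finset.sum_congr rfl fun i _ => h i]
  simp
  field_simp

/-- The sum factorizes over coordinates: each one in `T` contributes `∑ j, g j`, each free one
contributes `n`. -/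
theorem sum_prod_apply {k n : ℕ} (T : Finset (Fin k)) (g : Fin n → ℝ) :
    ∑ i : Fin k → Fin n, ∏ a ∈ T, g (i a) = (∑ j, g j) ^ T.card * (n : ℝ) ^ (k - T.card) := by
  have h1 : ∀ i : Fin k → Fin n, ∏ a ∈ T, g (i a) = ∏ a, if a ∈ T then g (i a) else 1 := by
    intro i; simp
  rw [Finset.sum_congr rfl fun i _ => h1 i]
  have h2 := Finset.prod_univ_sum (fun _ : Fin k => (Finset.univ : Finset (Fin n)))
    (fun a j => if a ∈ T then g j else 1)
  rw [Fintype.piFinset_univ] at h2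
  rw [← h2]
  have h3 : ∀ a : Fin k, (∑ j, if a ∈ T then g j else 1) = if a ∈ T then ∑ j, g j else (n : ℝ) := by
    intro a; split_ifs <;> simp
  rw [Finset.prod_congr rfl fun a _ => h3 a, Finset.prod_ite]
  simp [Finset.filter_not, Finset.card_sdiff]

/-- The overlap of two configurations. -/
noncomputable def overlap {n : ℕ} (σ τ : Config n) : ℝ :=
  (1 / (n : ℝ)) * ∑ j, (σ j).toReal * (τ j).toReal

omit [NeZero n] in
-- Grouping the sets by cardinality yields the Fourier weights. The empty set is split off because
-- `mixture` starts at degree `1`.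
theorem eval_mixture (r : ℝ) :
    ∑ T : Finset (Fin k), (∫ f, fourierCoeff f T ^ 2 ∂Λ) * r ^ T.card
      = ∫ f, fourierCoeff f ∅ ^ 2 ∂Λ + (mixture Λ).eval r := by
  have h1 : ∀ j, ∫ f, fourierWeight f j ∂Λ
      = ∑ T : Finset (Fin k) with T.card = j, ∫ f, fourierCoeff f T ^ 2 ∂Λ := by
    intro j
    unfold fourierWeight
    rw [integral_finsetSum _ fun T _ => integrable_sq_fourierCoeff Λ T]
  have h2 : ∑ T : Finset (Fin k), (∫ f, fourierCoeff f T ^ 2 ∂Λ) * r ^ T.card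
      = ∑ j ∈ Finset.range (k + 1), (∫ f, fourierWeight f j ∂Λ) * r ^ j := by
    rw [← Finset.sum_fiberwise_of_maps_to (s := Finset.univ) (t := Finset.range (k + 1))
      (g := fun T : Finset (Fin k) => T.card)
      (fun T _ => by
        have := T.card_le_univ
        rw [Fintype.card_fin] at this
        exact Finset.mem_range.2 (by omega))]
    refine Finset.sum_congr rfl fun j _ => ?_
    rw [h1, Finset.sum_mul]
    refine Finset.sum_congr rfl fun T hT => ?_
    rw [(Finset.mem_filter.1 hT).2]
  rw [h2, Finset.sum_range_succ', add_comm]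
  congr 1
  · rw [h1]
    simp [Finset.card_eq_zero, Finset.filter_eq']
  · unfold mixture
    rw [Polynomial.eval_finsetSum, Finset.range_eq_Ico,
      Finset.sum_Ico_add' (fun j => (∫ f, fourierWeight f j ∂Λ) * r ^ j) 0 k 1]
    simp only [Polynomial.eval_monomial]
    rfl

/-- After the change of variables `ρ = ε · σ(i)`, the predicate is evaluated at the uniform point
`ρ` and at `ρ · c` with `c = σ(i) · τ(i)`. Its noise correlation is `∑_T f̂(T)² ∏_{a ∈ T} c_a`, and
averaging over the independent indices turns the product into the overlap to the power `|T|`. -/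
theorem integral_value_mul_value (σ τ : Config n) :
    ∫ e, Clause.value e σ * Clause.value e τ ∂(clauseLaw Λ n)
      = ∫ f, fourierCoeff f ∅ ^ 2 ∂Λ + (mixture Λ).eval (overlap σ τ) := by
  have hn : (n : ℝ) ≠ 0 := NeZero.ne _
  have hm : Measurable (fun e : Clause k n => e.value σ * e.value τ) :=
    (measurable_value σ).mul (measurable_value τ)
  rw [integral_clauseLaw Λ hm 1 (fun e => by
    rw [abs_mul]; exact mul_le_one₀ (abs_value_le e σ) (abs_nonneg _) (abs_value_le e τ)),
    ← eval_mixture]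
  have h : ∀ i : Fin k → Fin n,
      ∫ f, (1 / 2 ^ k) * ∑ ε : Config k, Clause.value (i, f, ε) σ * Clause.value (i, f, ε) τ ∂Λ
      = ∑ T : Finset (Fin k), (∫ f, fourierCoeff f T ^ 2 ∂Λ)
        * ∏ a ∈ T, ((σ (i a)).toReal * (τ (i a)).toReal) := by
    intro i
    have h1 : ∀ f : Predicate k, (1 / 2 ^ k) * ∑ ε : Config k,
        Clause.value (i, f, ε) σ * Clause.value (i, f, ε) τ
        = ∑ T : Finset (Fin k), fourierCoeff f T ^ 2
          * ∏ a ∈ T, ((σ (i a)).toReal * (τ (i a)).toReal) := by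
      intro f
      have h2 := sum_sq_fourierCoeff_mul_prod f (fun a => σ (i a) * τ (i a))
      simp only [Spin.toReal_mul] at h2
      rw [h2]
      congr 1
      rw [← Equiv.sum_comp (Equiv.mulRight (fun a => σ (i a) : Config k))
        (fun ρ => (f ρ : ℝ) * (f (ρ * fun a => σ (i a) * τ (i a)) : ℝ))]
      refine Finset.sum_congr rfl fun ε _ => ?_
      have hτ : (fun a => ε a * τ (i a))
          = (ε * fun a => σ (i a)) * fun a => σ (i a) * τ (i a) := by
        funext a
        simp only [Pi.mul_apply]
        rw [mul_assoc, ← mul_assoc (σ (i a)), Int.units_mul_self, one_mul]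
      simp only [Clause.value, hτ]
      rfl
    simp_rw [h1]
    rw [integral_finsetSum _ fun T _ => (integrable_sq_fourierCoeff Λ T).mul_const _]
    simp_rw [integral_mul_const]
  rw [Finset.sum_congr rfl fun i _ => h i, Finset.sum_comm, Finset.mul_sum]
  refine Finset.sum_congr rfl fun T _ => ?_
  rw [← Finset.mul_sum, sum_prod_apply T (fun j => (σ j).toReal * (τ j).toReal)]
  have hT : T.card ≤ k := by simpa using T.card_le_univ
  unfold overlap
  have h3 : (n : ℝ) ^ k = (n : ℝ) ^ T.card * (n : ℝ) ^ (k - T.card) := by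
    rw [← pow_add, Nat.add_sub_cancel' hT]
  rw [h3, mul_pow, one_div, one_div, inv_pow]
  field_simp

end CSPGlass

/-! ### Gaussian random fields -/

section GaussianField

variable {X : Type*} [Fintype X]

/-- `μ` has the mean, the covariances `D` and the one-dimensional exponential moments of a centred
Gaussian random field with covariance `D`. -/
structure GaussianField (μ : Measure (X → ℝ)) (D : X → X → ℝ) : Prop where
  expMoments : ExpMoments μ
  mean : ∀ x, ∫ y, y x ∂μ = 0
  cov : ∀ x z, ∫ y, y x * y z ∂μ = D x z
  mgf : ∀ c x, ∫ y, Real.exp (c * y x) ∂μ = Real.exp (c ^ 2 * D x x / 2)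

theorem gaussianField_dirac_zero : GaussianField (Measure.dirac (0 : X → ℝ)) 0 :=
  ⟨expMoments_dirac 0, fun x => by simp, fun x z => by simp, fun c x => by simp⟩

/-- Centring kills the cross terms of the covariance, and moment generating functions multiply.
These data suffice for the exchange, so a joint Gaussian law is never needed. -/
theorem GaussianField.conv {μ ν : Measure (X → ℝ)} {D D' : X → X → ℝ} (h : GaussianField μ D)
    (h' : GaussianField ν D') : GaussianField (Measure.conv μ ν) (D + D') := by
  have hμ := h.expMoments
  have hν := h'.expMoments
  have := hμ.prob
  have := hν.prob
  refine ⟨hμ.conv hν, fun x => ?_, fun x z => ?_, fun c x => ?_⟩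
  · rw [integral_conv_of_le hμ hν (by fun_prop) _ _ fun w => abs_apply_le_exp_norm w x]
    have e : ∀ w : X → ℝ, ∫ y : X → ℝ, (w + y) x ∂ν = w x := fun w => by
      simp only [Pi.add_apply]
      rw [integral_add (integrable_const _) (hν.integrable_apply x), h'.mean]
      simp
    simp_rw [e, h.mean]
  · rw [integral_conv_of_le hμ hν (by fun_prop) _ _ fun w => abs_apply_mul_apply_le_exp_norm w x z]
    have e : ∀ w : X → ℝ, ∫ y : X → ℝ, (w + y) x * (w + y) z ∂ν = w x * w z + D' x z := fun w => by
      have e1 : ∀ y : X → ℝ, (w + y) x * (w + y) z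
          = w x * w z + w x * y z + w z * y x + y x * y z := fun y => by
        simp only [Pi.add_apply]; ring
      simp_rw [e1]
      have i1 := (hν.integrable_apply z).const_mul (w x)
      have i2 := (hν.integrable_apply x).const_mul (w z)
      have i3 : Integrable (fun y : X → ℝ => w x * w z + w x * y z) ν :=
        (integrable_const _).add i1
      have i4 : Integrable (fun y : X → ℝ => w x * w z + w x * y z + w z * y x) ν := i3.add i2
      rw [integral_add i4 (hν.integrable_apply_mul_apply x z), integral_add i3 i2,
        integral_add (integrable_const _) i1, integral_const_mul (w x) (fun y : X → ℝ => y z),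
        integral_const_mul (w z) (fun y : X → ℝ => y x), h'.mean, h'.mean, h'.cov]
      simp
    simp_rw [e]
    rw [integral_add (hμ.integrable_apply_mul_apply x z) (integrable_const _), h.cov]
    simp
  · rw [integral_conv_of_le hμ hν (by fun_prop) _ _ fun w => abs_exp_mul_apply_le_exp_norm c w x]
    simp only [Pi.add_apply, mul_add, Real.exp_add]
    simp_rw [integral_const_mul, integral_mul_const, h.mgf, h'.mgf]
    rw [← Real.exp_add]
    congr 1
    ring

theorem GaussianField.integral_exp_abs_le {μ : Measure (X → ℝ)} {D : X → X → ℝ}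
    (h : GaussianField μ D) (c : ℝ) (x : X) :
    ∫ y, Real.exp (c * |y x|) ∂μ ≤ 2 * Real.exp (c ^ 2 * D x x / 2) := by
  have hi := h.expMoments.integrable_exp_mul_apply
  calc ∫ y, Real.exp (c * |y x|) ∂μ
      ≤ ∫ y, (Real.exp (c * y x) + Real.exp (-c * y x)) ∂μ := by
        refine integral_mono_of_nonneg (ae_of_all _ fun y => (Real.exp_pos _).le)
          ((hi c x).add (hi (-c) x)) (ae_of_all _ fun y => ?_)
        simp only
        rcases abs_choice (y x) with h1 | h1 <;> rw [h1]
        · linarith [Real.exp_pos (-c * y x)]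
        · rw [mul_neg, ← neg_mul]
          linarith [Real.exp_pos (c * y x)]
    _ = _ := by
        rw [integral_add (hi c x) (hi (-c) x), h.mgf, h.mgf, neg_sq]
        ring

theorem integrable_exp_abs_gaussianReal (c : ℝ) :
    Integrable (fun s => Real.exp (c * |s|)) (gaussianReal 0 1) := by
  refine ((integrable_exp_mul_gaussianReal c).add (integrable_exp_mul_gaussianReal (-c))).mono'
    (by fun_prop : Continuous fun s : ℝ => Real.exp (c * |s|)).aestronglyMeasurable
    (ae_of_all _ fun s => ?_)
  rw [Real.norm_eq_abs, Real.abs_exp]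
  simp only [Pi.add_apply]
  rcases abs_choice s with h1 | h1 <;> rw [h1]
  · linarith [Real.exp_pos (-c * s)]
  · rw [mul_neg, ← neg_mul]
    linarith [Real.exp_pos (c * s)]

theorem integral_sq_gaussianReal : ∫ s, s * s ∂(gaussianReal 0 1) = 1 := by
  have h := variance_fun_id_gaussianReal (μ := 0) (v := 1)
  rw [variance_eq_integral (by fun_prop)] at h
  simpa [integral_id_gaussianReal, sq] using h

theorem expMoments_gaussian_smul (u : X → ℝ) :
    ExpMoments ((gaussianReal 0 1).map fun s : ℝ => s • u) := by
  refine expMoments_map (by fun_prop) fun c => ?_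
  have h := integrable_exp_abs_gaussianReal (c * ‖u‖)
  refine h.congr (ae_of_all _ fun s => ?_)
  simp only [norm_smul, Real.norm_eq_abs]
  ring_nf

theorem gaussianField_smul (u : X → ℝ) :
    GaussianField ((gaussianReal 0 1).map fun s : ℝ => s • u) (fun x z => u x * u z) := by
  have hm : AEMeasurable (fun s : ℝ => s • u) (gaussianReal 0 1) := by fun_prop
  refine ⟨expMoments_gaussian_smul u, fun x => ?_, fun x z => ?_, fun c x => ?_⟩
  · rw [integral_map hm (Continuous.aestronglyMeasurable (by fun_prop))]
    simp only [Pi.smul_apply, smul_eq_mul]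
    rw [integral_mul_const, integral_id_gaussianReal, zero_mul]
  · rw [integral_map hm (Continuous.aestronglyMeasurable (by fun_prop))]
    simp only [Pi.smul_apply, smul_eq_mul]
    simp_rw [mul_mul_mul_comm _ (u x) _ (u z)]
    rw [integral_mul_const, integral_sq_gaussianReal, one_mul]
  · rw [integral_map hm (Continuous.aestronglyMeasurable (by fun_prop))]
    have h := mgf_gaussianReal (p := gaussianReal 0 1) (X := id) (by simp : _ = gaussianReal 0 1)
      (c * u x)
    simp only [mgf, id, zero_mul, zero_add, NNReal.coe_one, one_mul] at h
    simp only [Pi.smul_apply, smul_eq_mul]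
    convert h using 2
    · ext s; ring_nf
    · ring

theorem varianceBound_gaussian_smul (u : X → ℝ) :
    VarianceBound ((gaussianReal 0 1).map fun s : ℝ => s • u) (‖u‖ ^ 2) := by
  refine varianceBound_of_integral_sq_le (expMoments_gaussian_smul u) ?_
  rw [integral_map (by fun_prop) (by fun_prop)]
  simp_rw [norm_smul, mul_pow, Real.norm_eq_abs, sq_abs, sq]
  rw [integral_mul_const, integral_sq_gaussianReal, one_mul]

/-- Variances of independent Gaussians add; the identity is transported from the line to the
direction of `u`. -/
theorem gaussian_smul_add (u : X → ℝ) {v w : ℝ} (hv : 0 ≤ v) (hw : 0 ≤ w) :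
    (gaussianReal 0 1).map (fun s : ℝ => s • (√(v + w) • u))
      = Measure.conv ((gaussianReal 0 1).map fun s : ℝ => s • (√v • u))
        ((gaussianReal 0 1).map fun s : ℝ => s • (√w • u)) := by
  let L : ℝ →L[ℝ] (X → ℝ) := ContinuousLinearMap.toSpanSingleton ℝ u
  have key : ∀ r : ℝ, 0 ≤ r → (gaussianReal 0 1).map (fun s : ℝ => s • (√r • u))
      = (gaussianReal 0 r.toNNReal).map L := by
    intro r hr
    have h1 := gaussianReal_map_const_mul (μ := 0) (v := 1) √r
    have h2 : gaussianReal 0 r.toNNReal = (gaussianReal 0 1).map (√r * ·) := by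
      rw [h1]
      congr 1
      · simp
      · ext
        simp [Real.coe_toNNReal r hr, Real.sq_sqrt hr]
    rw [h2, Measure.map_map (by fun_prop) (by fun_prop)]
    congr 1
    ext s x
    simp [L]
    ring
  rw [key _ (add_nonneg hv hw), key v hv, key w hw, ← Measure.map_conv_continuousLinearMap,
    gaussianReal_conv_gaussianReal, Real.toNNReal_add hv hw, add_zero]

end GaussianField

namespace CSPGlass

/-! ### Fields that are linear in Gaussian disorder -/

section Disorder

variable {k n : ℕ} {X : Type*} [Fintype X]

instance : IsProbabilityMeasure (gaussianDisorder k n) := by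
  unfold gaussianDisorder
  infer_instance

/-- The law of the linear combination of the vectors `u p i` with Gaussian disorder coefficients. -/
noncomputable def disorderLaw (u : (p : Fin k) → (Fin ((p : ℕ) + 1) → Fin n) → X → ℝ) :
    Measure (X → ℝ) :=
  (gaussianDisorder k n).map fun J => ∑ p, ∑ i, J p i • u p i

/-- The disorder is a product over `p` of products over `i`, so induction on independent sums is
applied twice and reduces the property to a single Gaussian coefficient. -/
theorem disorderLaw_induction {τ M : Type*} [AddCommMonoid M]
    (r : (τ → Measure (X → ℝ)) → M → Prop)
    (hzero : r (fun _ => Measure.dirac 0) 0)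
    (hconv : ∀ μ ν c d, r μ c → r ν d → r (fun a => Measure.conv (μ a) (ν a)) (c + d))
    (u : τ → (p : Fin k) → (Fin ((p : ℕ) + 1) → Fin n) → X → ℝ)
    (c : (p : Fin k) → (Fin ((p : ℕ) + 1) → Fin n) → M)
    (h : ∀ p i, r (fun a => (gaussianReal 0 1).map fun s : ℝ => s • u a p i) (c p i)) :
    r (fun a => disorderLaw (u a)) (∑ p, ∑ i, c p i) := by
  unfold disorderLaw gaussianDisorder
  refine law_sum_induction r hzero hconv (P := Measure.pi fun p : Fin k => Measure.pi
    fun _ : Fin ((p : ℕ) + 1) → Fin n => gaussianReal 0 1)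
    (fun a (p : Fin k) J => ∑ i, J p i • u a p i) (fun a p => Measurable.aemeasurable (by fun_prop)) (fun a =>
      iIndepFun_pi (X := fun (p : Fin k) (Jp : (Fin ((p : ℕ) + 1) → Fin n) → ℝ) =>
        ∑ i, Jp i • u a p i) (fun p => Measurable.aemeasurable (by fun_prop))) _ _ fun p _ => ?_
  have e1 : ∀ a, (Measure.pi fun p : Fin k => Measure.pi
      fun _ : Fin ((p : ℕ) + 1) → Fin n => gaussianReal 0 1).map (fun J => ∑ i, J p i • u a p i)
      = (Measure.pi fun _ : Fin ((p : ℕ) + 1) → Fin n => gaussianReal 0 1).map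
        (fun Jp => ∑ i, Jp i • u a p i) := by
    intro a
    rw [← (measurePreserving_eval (fun p : Fin k => Measure.pi
      fun _ : Fin ((p : ℕ) + 1) → Fin n => gaussianReal 0 1) p).map_eq,
      Measure.map_map (by fun_prop) (by fun_prop)]
    rfl
  simp_rw [e1]
  refine law_sum_induction r hzero hconv
    (P := Measure.pi fun _ : Fin ((p : ℕ) + 1) → Fin n => gaussianReal 0 1)
    (fun a i Jp => Jp i • u a p i) (fun a i => Measurable.aemeasurable (by fun_prop)) (fun a =>
      iIndepFun_pi (X := fun i (s : ℝ) => s • u a p i) (fun i => Measurable.aemeasurable (by fun_prop))) _ _ fun i _ => ?_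
  have e2 : ∀ a, (Measure.pi fun _ : Fin ((p : ℕ) + 1) → Fin n => gaussianReal 0 1).map
        (fun Jp => Jp i • u a p i) = (gaussianReal 0 1).map (fun s : ℝ => s • u a p i) := by
    intro a
    conv_rhs => rw [← (measurePreserving_eval (fun _ : Fin ((p : ℕ) + 1) → Fin n =>
      gaussianReal 0 1) i).map_eq, Measure.map_map (by fun_prop) (by fun_prop)]
    rfl
  simp_rw [e2]
  exact h p i

theorem disorderLaw_induction_single {M : Type*} [AddCommMonoid M]
    (r : Measure (X → ℝ) → M → Prop) (hzero : r (Measure.dirac 0) 0)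
    (hconv : ∀ μ ν c d, r μ c → r ν d → r (Measure.conv μ ν) (c + d))
    (u : (p : Fin k) → (Fin ((p : ℕ) + 1) → Fin n) → X → ℝ)
    (c : (p : Fin k) → (Fin ((p : ℕ) + 1) → Fin n) → M)
    (h : ∀ p i, r ((gaussianReal 0 1).map fun s : ℝ => s • u p i) (c p i)) :
    r (disorderLaw u) (∑ p, ∑ i, c p i) := by
  have hconv' : ∀ (μ ν : Unit → Measure (X → ℝ)) (c d : M), r (μ ()) c → r (ν ()) d →
      r (Measure.conv (μ ()) (ν ())) (c + d) := fun μ ν c d => hconv _ _ c d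
  exact disorderLaw_induction (fun μ : Unit → Measure (X → ℝ) => r (μ ())) hzero hconv'
    (fun _ => u) c h

variable (u : (p : Fin k) → (Fin ((p : ℕ) + 1) → Fin n) → X → ℝ)

theorem gaussianField_disorderLaw :
    GaussianField (disorderLaw u) (fun x z => ∑ p, ∑ i, u p i x * u p i z) := by
  have h := disorderLaw_induction_single GaussianField
    gaussianField_dirac_zero (fun _ _ _ _ h h' => h.conv h') u
    (fun p i => fun x z => u p i x * u p i z) (fun p i => gaussianField_smul _)
  convert h using 1
  ext x z
  simp

theorem varianceBound_disorderLaw :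
    VarianceBound (disorderLaw u) (∑ p, ∑ i, ‖u p i‖ ^ 2) := by
  have hzero : VarianceBound (Measure.dirac (0 : X → ℝ)) 0 := varianceBound_dirac_zero
  have hconv : ∀ (μ ν : Measure (X → ℝ)) (c d : ℝ), VarianceBound μ c → VarianceBound ν d →
      VarianceBound (Measure.conv μ ν) (c + d) := fun _ _ _ _ h h' => VarianceBound.conv h h'
  have hbase : ∀ v : X → ℝ, VarianceBound ((gaussianReal 0 1).map fun s : ℝ => s • v) (‖v‖ ^ 2) :=
    varianceBound_gaussian_smul
  exact disorderLaw_induction_single VarianceBound hzero hconv u _ fun p i => hbase (u p i)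

/-- The identity holds for each coefficient and is stable under convolution by commutativity and
associativity. It is what merges the fields of separate clauses into a single spin glass. -/
theorem disorderLaw_sqrt_add {v w : ℝ} (hv : 0 ≤ v) (hw : 0 ≤ w) :
    disorderLaw (fun p i => √(v + w) • u p i)
      = Measure.conv (disorderLaw fun p i => √v • u p i) (disorderLaw fun p i => √w • u p i) := by
  -- Three laws are followed at once: `none` for the total variance `v + w`, and `some true`, `some
  -- false` for its two parts. The additive parameter in `ℕ` is a dummy.
  let q : Option Bool → ℝ := fun a => a.elim (v + w) fun a => cond a v w
  let r : (Option Bool → Measure (X → ℝ)) → ℕ → Prop := fun μ _ =>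
    IsProbabilityMeasure (μ (some true)) ∧ IsProbabilityMeasure (μ (some false)) ∧
      μ none = Measure.conv (μ (some true)) (μ (some false))
  have hzero : r (fun _ => Measure.dirac 0) 0 :=
    ⟨inferInstance, inferInstance, (Measure.dirac_zero_conv _).symm⟩
  have hconv : ∀ μ ν c d, r μ c → r ν d → r (fun a => Measure.conv (μ a) (ν a)) (c + d) := by
    rintro μ ν c d ⟨i1, i2, h1⟩ ⟨j1, j2, h2⟩
    refine ⟨inferInstance, inferInstance, ?_⟩
    simp only [h1, h2]
    rw [Measure.conv_assoc, Measure.conv_assoc, ← Measure.conv_assoc (μ (some false)),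
      Measure.conv_comm (μ (some false)) (ν (some true)), Measure.conv_assoc]
  exact (disorderLaw_induction r hzero hconv (fun a p i => √(q a) • u p i) (fun _ _ => 0)
    (fun p i => ⟨Measure.isProbabilityMeasure_map (by fun_prop),
      Measure.isProbabilityMeasure_map (by fun_prop), gaussian_smul_add (u p i) hv hw⟩)).2.2

theorem disorderLaw_zero :
    disorderLaw (fun (p : Fin k) (_ : Fin ((p : ℕ) + 1) → Fin n) => (0 : X → ℝ))
      = Measure.dirac 0 := by
  unfold disorderLaw
  simp

theorem map_smul_disorderLaw (t : ℝ) :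
    (disorderLaw u).map (fun y => t • y) = disorderLaw fun p i => t • u p i := by
  unfold disorderLaw
  rw [Measure.map_map (by fun_prop) (by fun_prop)]
  congr 1
  ext J x
  simp only [Function.comp, Pi.smul_apply, Finset.sum_apply, smul_eq_mul, Finset.mul_sum]
  refine Finset.sum_congr rfl fun p _ => Finset.sum_congr rfl fun i _ => ?_
  ring

end Disorder

end CSPGlass

/-! ### The fields of a single hidden instance -/

namespace CSPGlass

section Column

variable {k ℓ n : ℕ}

/-- The contribution of a hidden Hamiltonian to the grand Hamiltonian. -/
def tupleField (a : Fin ℓ → ℝ) (h : Hamiltonian n) : (Fin ℓ → Config n) → ℝ :=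
  fun x => ∑ j, a j * h (x j)

theorem measurable_tupleField (a : Fin ℓ → ℝ) :
    Measurable (tupleField a : Hamiltonian n → (Fin ℓ → Config n) → ℝ) := by
  unfold tupleField
  fun_prop

/-- The contribution of a clause to the grand Hamiltonian. -/
def clauseField (a : Fin ℓ → ℝ) (e : Clause k n) : (Fin ℓ → Config n) → ℝ :=
  tupleField a e.value

theorem measurable_clauseField (a : Fin ℓ → ℝ) :
    Measurable (clauseField a : Clause k n → (Fin ℓ → Config n) → ℝ) :=
  (measurable_tupleField a).comp (measurable_pi_lambda _ fun σ => measurable_value σ)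

/-- The coefficient vectors of the Gaussian field with covariance
`∑ j, ∑ j', a j * a j' * ξ(R(x_j, z_j'))`. -/
noncomputable def glassVector (ξ : Polynomial ℝ) (a : Fin ℓ → ℝ) (p : Fin k)
    (i : Fin ((p : ℕ) + 1) → Fin n) : (Fin ℓ → Config n) → ℝ :=
  fun x => √(ξ.coeff ((p : ℕ) + 1)) / √((n : ℝ) ^ ((p : ℕ) + 1)) *
    ∑ j, a j * ∏ b, (x j (i b)).toReal

theorem abs_sum_mul_le {a : Fin ℓ → ℝ} (ha : ∀ j, a j = 0 ∨ a j = 1) {g : Fin ℓ → ℝ}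
    (hg : ∀ j, |g j| ≤ 1) : |∑ j, a j * g j| ≤ ℓ := by
  refine (Finset.abs_sum_le_sum_abs _ _).trans ?_
  calc _ ≤ ∑ _j : Fin ℓ, (1 : ℝ) := by
        refine Finset.sum_le_sum fun j _ => ?_
        rw [abs_mul]
        rcases ha j with h | h <;> simp [h, hg j]
    _ = ℓ := by simp

theorem norm_clauseField_le {a : Fin ℓ → ℝ} (ha : ∀ j, a j = 0 ∨ a j = 1) (e : Clause k n) :
    ‖clauseField a e‖ ≤ ℓ :=
  (pi_norm_le_iff_of_nonneg (by positivity)).2 fun x =>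
    abs_sum_mul_le ha fun j => abs_value_le e (x j)

theorem abs_prod_toReal {ι : Type*} [Fintype ι] (s : ι → Spin) : |∏ b, (s b).toReal| = 1 := by
  rw [Finset.abs_prod]
  simp [Spin.abs_toReal]

theorem norm_glassVector_sq_le [NeZero n] {ξ : Polynomial ℝ} {p : Fin k}
    (hξ : 0 ≤ ξ.coeff ((p : ℕ) + 1)) {a : Fin ℓ → ℝ} (ha : ∀ j, a j = 0 ∨ a j = 1)
    (i : Fin ((p : ℕ) + 1) → Fin n) :
    ‖glassVector ξ a p i‖ ^ 2 ≤ ξ.coeff ((p : ℕ) + 1) / (n : ℝ) ^ ((p : ℕ) + 1) * (ℓ : ℝ) ^ 2 := by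
  have hn : (0 : ℝ) ≤ (n : ℝ) ^ ((p : ℕ) + 1) := by positivity
  have h : ‖glassVector ξ a p i‖ ≤ √(ξ.coeff ((p : ℕ) + 1)) / √((n : ℝ) ^ ((p : ℕ) + 1)) * ℓ := by
    refine (pi_norm_le_iff_of_nonneg (by positivity)).2 fun x => ?_
    unfold glassVector
    rw [Real.norm_eq_abs, abs_mul, abs_of_nonneg (by positivity)]
    gcongr
    exact abs_sum_mul_le ha fun j => (abs_prod_toReal _).le
  calc _ ≤ _ := pow_le_pow_left₀ (norm_nonneg _) h 2
    _ = _ := by rw [mul_pow, div_pow, Real.sq_sqrt hξ, Real.sq_sqrt hn]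

/-! ### Matching moments of clause fields and glass fields -/

variable (Λ : Measure (Predicate k)) [IsProbabilityMeasure Λ]

theorem coeff_mixture_nonneg (j : ℕ) : 0 ≤ (mixture Λ).coeff j := by
  unfold mixture
  rw [Polynomial.finsetSum_coeff]
  refine Finset.sum_nonneg fun i _ => ?_
  rw [Polynomial.coeff_monomial]
  split_ifs
  · exact integral_nonneg fun f => Finset.sum_nonneg fun T _ => sq_nonneg _
  · exact le_rfl

theorem eval_mixture_eq_sum (r : ℝ) :
    (mixture Λ).eval r = ∑ p : Fin k, (mixture Λ).coeff ((p : ℕ) + 1) * r ^ ((p : ℕ) + 1) := by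
  have hc : ∀ p : Fin k, (mixture Λ).coeff ((p : ℕ) + 1) = ∫ f, fourierWeight f ((p : ℕ) + 1) ∂Λ := by
    intro p
    unfold mixture
    rw [Polynomial.finsetSum_coeff]
    simp only [Polynomial.coeff_monomial]
    rw [Finset.sum_ite_eq_of_mem' _ _ _ (Finset.mem_Icc.2 ⟨by omega, p.2⟩)]
  simp_rw [hc]
  rw [Fin.sum_univ_eq_sum_range
    (fun p => (∫ f, fourierWeight f (p + 1) ∂Λ) * r ^ (p + 1)) k, Finset.range_eq_Ico,
    Finset.sum_Ico_add' (fun j => (∫ f, fourierWeight f j ∂Λ) * r ^ j) 0 k 1]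
  unfold mixture
  rw [Polynomial.eval_finsetSum]
  simp only [Polynomial.eval_monomial]
  rfl

theorem sum_glassVector_mul [NeZero n] (a : Fin ℓ → ℝ) (x z : Fin ℓ → Config n) :
    ∑ p : Fin k, ∑ i, glassVector (mixture Λ) a p i x * glassVector (mixture Λ) a p i z
      = ∑ j, ∑ j', a j * a j' * (mixture Λ).eval (overlap (x j) (z j')) := by
  have hn : (n : ℝ) ≠ 0 := NeZero.ne _
  simp_rw [eval_mixture_eq_sum, Finset.mul_sum]
  have h : ∀ j, ∑ j', ∑ p : Fin k, a j * a j' *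
      ((mixture Λ).coeff ((p : ℕ) + 1) * overlap (x j) (z j') ^ ((p : ℕ) + 1))
      = ∑ p : Fin k, ∑ j', a j * a j' *
      ((mixture Λ).coeff ((p : ℕ) + 1) * overlap (x j) (z j') ^ ((p : ℕ) + 1)) :=
    fun j => Finset.sum_comm
  simp_rw [h]
  rw [Finset.sum_comm]
  refine Finset.sum_congr rfl fun p _ => ?_
  have hξ := coeff_mixture_nonneg Λ ((p : ℕ) + 1)
  have hnp : (0 : ℝ) ≤ (n : ℝ) ^ ((p : ℕ) + 1) := by positivity
  have h1 : ∀ i : Fin ((p : ℕ) + 1) → Fin n,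
      glassVector (mixture Λ) a p i x * glassVector (mixture Λ) a p i z
      = ∑ j, ∑ j', a j * a j' * ((mixture Λ).coeff ((p : ℕ) + 1) / (n : ℝ) ^ ((p : ℕ) + 1)) *
        ∏ b, (fun q => (x j q).toReal * (z j' q).toReal) (i b) := by
    intro i
    unfold glassVector
    rw [mul_mul_mul_comm, div_mul_div_comm, Real.mul_self_sqrt hξ, Real.mul_self_sqrt hnp,
      Finset.sum_mul_sum, Finset.mul_sum]
    refine Finset.sum_congr rfl fun j _ => ?_
    rw [Finset.mul_sum]
    refine Finset.sum_congr rfl fun j' _ => ?_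
    rw [Finset.prod_mul_distrib]
    ring
  simp_rw [h1]
  rw [Finset.sum_comm]
  refine Finset.sum_congr rfl fun j _ => ?_
  rw [Finset.sum_comm]
  refine Finset.sum_congr rfl fun j' _ => ?_
  have h2 := sum_prod_apply (Finset.univ : Finset (Fin ((p : ℕ) + 1)))
    (fun q => (x j q).toReal * (z j' q).toReal)
  simp only [Finset.card_univ, Fintype.card_fin, Nat.sub_self, pow_zero, mul_one] at h2
  rw [← Finset.mul_sum, h2]
  unfold overlap
  rw [mul_pow, one_div, inv_pow]
  field_simp

variable [NeZero n]

theorem expMoments_clauseField {a : Fin ℓ → ℝ} (ha : ∀ j, a j = 0 ∨ a j = 1) :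
    ExpMoments ((clauseLaw Λ n).map (clauseField a)) :=
  expMoments_map_of_le (measurable_clauseField a).aemeasurable ℓ (norm_clauseField_le ha)

theorem integrable_value (σ : Config n) :
    Integrable (fun e : Clause k n => e.value σ) (clauseLaw Λ n) :=
  Integrable.of_bound (measurable_value σ).aestronglyMeasurable 1
    (ae_of_all _ fun e => abs_value_le e σ)

theorem integrable_value_mul_value (σ τ : Config n) :
    Integrable (fun e : Clause k n => e.value σ * e.value τ) (clauseLaw Λ n) :=
  Integrable.of_bound ((measurable_value σ).mul (measurable_value τ)).aestronglyMeasurable 1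
    (ae_of_all _ fun e => by
      rw [norm_mul]; exact mul_le_one₀ (abs_value_le e σ) (norm_nonneg _) (abs_value_le e τ))

theorem mean_clauseField (a : Fin ℓ → ℝ) (x : Fin ℓ → Config n) :
    ∫ y, y x ∂((clauseLaw Λ n).map (clauseField a)) = (∑ j, a j) * meanValue Λ := by
  rw [integral_map (measurable_clauseField a).aemeasurable
    (Continuous.aestronglyMeasurable (by fun_prop))]
  unfold clauseField tupleField
  rw [integral_finsetSum _ fun j _ => (integrable_value Λ (x j)).const_mul _]
  simp_rw [integral_const_mul, integral_value]
  rw [Finset.sum_mul]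

/-- The excess over the glass covariance, coming from the Fourier coefficient at `∅`, depends on
neither `x` nor `z`; this is the `κ` that the exchange tolerates. -/
theorem cov_clauseField (a : Fin ℓ → ℝ) (x z : Fin ℓ → Config n) :
    ∫ y, y x * y z ∂((clauseLaw Λ n).map (clauseField a))
      = ∑ p : Fin k, ∑ i, glassVector (mixture Λ) a p i x * glassVector (mixture Λ) a p i z
        + (∑ j, a j) ^ 2 * ∫ f, fourierCoeff f ∅ ^ 2 ∂Λ := by
  rw [integral_map (measurable_clauseField a).aemeasurable
    (Continuous.aestronglyMeasurable (by fun_prop)), sum_glassVector_mul]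
  have h1 : ∀ e : Clause k n, clauseField a e x * clauseField a e z
      = ∑ j, ∑ j', a j * a j' * (e.value (x j) * e.value (z j')) := by
    intro e
    unfold clauseField tupleField
    rw [Finset.sum_mul_sum]
    exact Finset.sum_congr rfl fun j _ => Finset.sum_congr rfl fun j' _ => by ring
  simp_rw [h1]
  rw [integral_finsetSum _ fun j _ => integrable_finsetSum _ fun j' _ =>
    (integrable_value_mul_value Λ (x j) (z j')).const_mul _, sq, Finset.sum_mul_sum, Finset.sum_mul,
    ← Finset.sum_add_distrib]
  refine Finset.sum_congr rfl fun j _ => ?_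
  rw [integral_finsetSum _ fun j' _ =>
    (integrable_value_mul_value Λ (x j) (z j')).const_mul _, Finset.sum_mul,
    ← Finset.sum_add_distrib]
  refine Finset.sum_congr rfl fun j' _ => ?_
  rw [integral_const_mul, integral_value_mul_value]
  ring

/-- The glass variance is the second moment of a clause field minus a nonnegative constant, and a
clause field is bounded by `ℓ`. The bound is therefore independent of `k` and `Λ`. -/
theorem sum_glassVector_sq_le {a : Fin ℓ → ℝ} (ha : ∀ j, a j = 0 ∨ a j = 1)
    (x : Fin ℓ → Config n) :
    ∑ p : Fin k, ∑ i, glassVector (mixture Λ) a p i x * glassVector (mixture Λ) a p i x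
      ≤ (ℓ : ℝ) ^ 2 := by
  have h := cov_clauseField Λ a x x
  have h1 : 0 ≤ (∑ j, a j) ^ 2 * ∫ f, fourierCoeff f ∅ ^ 2 ∂Λ :=
    mul_nonneg (sq_nonneg _) (integral_nonneg fun f => sq_nonneg _)
  have h2 : ∫ y, y x * y x ∂((clauseLaw Λ n).map (clauseField a)) ≤ (ℓ : ℝ) ^ 2 := by
    rw [integral_map (measurable_clauseField a).aemeasurable
      (Continuous.aestronglyMeasurable (by fun_prop))]
    have h3 := norm_integral_le_of_norm_le_const (μ := clauseLaw Λ n) (C := (ℓ : ℝ) ^ 2)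
      (f := fun e => clauseField a e x * clauseField a e x) (ae_of_all _ fun e => by
        rw [← sq, norm_pow]
        exact pow_le_pow_left₀ (norm_nonneg _) ((norm_le_pi_norm _ x).trans
          (norm_clauseField_le ha e)) 2)
    rw [probReal_univ, mul_one] at h3
    exact (le_abs_self _).trans h3
  linarith

/-- The bound on the exponential moments of the fields, which depends on `ℓ` only. -/
noncomputable def momentBound (ℓ : ℕ) : ℝ := 2 * Real.exp (32 * (ℓ : ℝ) ^ 2)

theorem integral_exp_clauseField_le {a : Fin ℓ → ℝ} (ha : ∀ j, a j = 0 ∨ a j = 1)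
    (x : Fin ℓ → Config n) :
    ∫ y, Real.exp (8 * |y x|) ∂((clauseLaw Λ n).map (clauseField a)) ≤ momentBound ℓ := by
  rw [integral_map (measurable_clauseField a).aemeasurable
    (Continuous.aestronglyMeasurable (by fun_prop))]
  have h3 := norm_integral_le_of_norm_le_const (μ := clauseLaw Λ n) (C := momentBound ℓ)
    (f := fun e => Real.exp (8 * |clauseField a e x|)) (ae_of_all _ fun e => by
      rw [Real.norm_eq_abs, Real.abs_exp]
      have h : |clauseField a e x| ≤ ℓ := (norm_le_pi_norm _ x).trans (norm_clauseField_le ha e)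
      have hl : (ℓ : ℝ) ≤ (ℓ : ℝ) ^ 2 := by exact_mod_cast Nat.le_self_pow two_ne_zero ℓ
      have h4 : Real.exp (8 * |clauseField a e x|) ≤ Real.exp (32 * (ℓ : ℝ) ^ 2) := by
        rw [Real.exp_le_exp]
        nlinarith [sq_nonneg (ℓ : ℝ)]
      unfold momentBound
      linarith [Real.exp_pos (32 * (ℓ : ℝ) ^ 2)])
  rw [probReal_univ, mul_one] at h3
  exact (le_abs_self _).trans h3

theorem momentBound_pos (ℓ : ℕ) : 0 < momentBound ℓ := by
  unfold momentBound
  positivity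

/-- A Gaussian of variance at most `ℓ ^ 2` has `E exp (8 |y|) ≤ 2 exp (8² ℓ² / 2)`, which determines
`momentBound`. -/
theorem integral_exp_glass_le {a : Fin ℓ → ℝ} (ha : ∀ j, a j = 0 ∨ a j = 1)
    (x : Fin ℓ → Config n) :
    ∫ y, Real.exp (8 * |y x|) ∂(disorderLaw (k := k) (glassVector (n := n) (mixture Λ) a))
      ≤ momentBound ℓ := by
  refine ((gaussianField_disorderLaw _).integral_exp_abs_le 8 x).trans ?_
  unfold momentBound
  gcongr
  have := sum_glassVector_sq_le Λ ha x
  linarith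

/-! ### Exchange and concentration for one hidden instance -/

variable {U : Finset (Fin ℓ → Config n)} (hU : U.Nonempty)

include hU

/-- A clause can be exchanged for a Gaussian field. -/
theorem exchange_clause {a : Fin ℓ → ℝ} (ha : ∀ j, a j = 0 ∨ a j = 1) {t : ℝ} (ht : 0 ≤ t)
    (ht1 : t ≤ 1) :
    Exchange (logSumExp U) ((clauseLaw Λ n).map fun e => t • clauseField a e)
      (disorderLaw fun (p : Fin k) i => t • glassVector (mixture Λ) a p i) (t * ((∑ j, a j) * meanValue Λ))
      (20 * momentBound ℓ * t ^ 3 * ∑ j, a j) := by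
  have hK := momentBound_pos ℓ
  have hG := gaussianField_disorderLaw (k := k) (glassVector (n := n) (mixture Λ) a)
  have h := exchange_of_covariance hU (expMoments_clauseField Λ ha) hG.expMoments
    (mean_clauseField Λ a) hG.mean (fun x z => by rw [cov_clauseField, hG.cov])
    (integral_exp_clauseField_le Λ ha) (integral_exp_glass_le Λ ha) ht ht1
  rw [map_smul_disorderLaw, Measure.map_map (by fun_prop) (measurable_clauseField a)] at h
  -- If the column is zero, both fields vanish and the exchange is free; otherwise the column sum is
  -- at least `1`. The error can thus carry the factor `∑ j, a j`, which makes the total over all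
  -- columns independent of `ℓ'` and `b`.
  by_cases h0 : ∀ j, a j = 0
  · have e1 : (fun e : Clause k n => t • clauseField a e) = fun _ => 0 := by
      ext e x; simp [clauseField, tupleField, h0]
    have e2 : (fun (p : Fin k) (i : Fin ((p : ℕ) + 1) → Fin n) =>
        t • glassVector (mixture Λ) a p i) = fun _ _ => 0 := by
      ext p i x; simp [glassVector, h0]
    rw [e1, e2, disorderLaw_zero]
    simp only [h0]
    simpa using Exchange.refl (logSumExp U) (expMoments_dirac (0 : (Fin ℓ → Config n) → ℝ))
  · push Not at h0
    obtain ⟨j, hj⟩ := h0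
    have hs : 1 ≤ ∑ j, a j := by
      have h1 : a j = 1 := (ha j).resolve_left hj
      rw [← h1]
      exact Finset.single_le_sum (f := a) (fun i _ => by rcases ha i with h | h <;> simp [h])
        (Finset.mem_univ j)
    refine ⟨h.left, h.right, fun w => (h.bound w).trans ?_⟩
    exact le_mul_of_one_le_right (by positivity) hs

/-- The last component of the additive parameter in the induction counts clauses: after `q`
exchanges the Gaussian side is one glass field scaled by `√q`, by `disorderLaw_sqrt_add`. -/
theorem exchange_clauses {a : Fin ℓ → ℝ} (ha : ∀ j, a j = 0 ∨ a j = 1) {t : ℝ} (ht : 0 ≤ t)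
    (ht1 : t ≤ 1) (m : ℕ) :
    Exchange (logSumExp U) ((Measure.pi fun _ : Fin m => clauseLaw Λ n).map
        fun E => ∑ e, t • clauseField a (E e))
      (disorderLaw fun (p : Fin k) i => √(m : ℝ) • t • glassVector (mixture Λ) a p i)
      (m * (t * ((∑ j, a j) * meanValue Λ)))
      (m * (20 * momentBound ℓ * t ^ 3 * ∑ j, a j)) := by
  have hL := lipschitz_logSumExp hU
  have hm : Measurable fun e : Clause k n => t • (clauseField a e : (Fin ℓ → Config n) → ℝ) :=
    (measurable_clauseField a).const_smul t
  have key := law_sum_induction_single (M := ℝ × ℝ × ℕ)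
    (P := Measure.pi fun _ : Fin m => clauseLaw Λ n)
    (fun μ q => Exchange (logSumExp U) μ
      (disorderLaw fun (p : Fin k) i => √(q.2.2 : ℝ) • t • glassVector (mixture Λ) a p i) q.1 q.2.1)
    (by
      simpa [disorderLaw_zero] using
        Exchange.refl (logSumExp U) (expMoments_dirac (0 : (Fin ℓ → Config n) → ℝ)))
    (fun μ ν c d h h' => by
      have h2 := h.conv hL h'
      rw [← disorderLaw_sqrt_add _ (Nat.cast_nonneg _) (Nat.cast_nonneg _)] at h2
      simpa using h2)
    (fun e E => t • clauseField a (E e))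
    (fun e => (((measurable_clauseField a).comp (measurable_pi_apply e)).const_smul t).aemeasurable)
    (iIndepFun_pi (X := fun _ e => t • clauseField a e)
      (fun _ => ((measurable_clauseField a).const_smul t).aemeasurable))
    (fun _ => (t * ((∑ j, a j) * meanValue Λ), 20 * momentBound ℓ * t ^ 3 * ∑ j, a j, 1))
    Finset.univ
    (fun e _ => by
      have e1 : (Measure.pi fun _ : Fin m => clauseLaw Λ n).map (fun E => t • clauseField a (E e))
          = (clauseLaw Λ n).map fun e => t • clauseField a e := by
        conv_rhs => rw [← (measurePreserving_eval (fun _ : Fin m => clauseLaw Λ n) e).map_eq,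
          Measure.map_map hm (measurable_pi_apply e)]
        rfl
      rw [e1]
      simpa using exchange_clause Λ hU ha ht ht1)
  simpa [Prod.fst_sum, Prod.snd_sum] using key

/-- The clauses of a hidden instance can be exchanged for the Gaussian field of the corresponding
hidden spin glass. -/
theorem exchange_instance {a : Fin ℓ → ℝ} (ha : ∀ j, a j = 0 ∨ a j = 1) {t : ℝ} (ht : 0 ≤ t)
    (ht1 : t ≤ 1) {v : ℝ} (hv : 0 ≤ v) :
    Exchange (logSumExp U) ((Measure.pi fun _ : Fin ⌊v⌋₊ => clauseLaw Λ n).map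
        fun E => ∑ e, t • clauseField a (E e))
      (disorderLaw fun (p : Fin k) i => √v • t • glassVector (mixture Λ) a p i)
      (⌊v⌋₊ * (t * ((∑ j, a j) * meanValue Λ)))
      (⌊v⌋₊ * (20 * momentBound ℓ * t ^ 3 * ∑ j, a j) + momentBound ℓ) := by
  have hL := lipschitz_logSumExp hU
  have h1 := exchange_clauses Λ hU ha ht ht1 ⌊v⌋₊
  have hθ : 0 ≤ v - ⌊v⌋₊ := sub_nonneg.2 (Nat.floor_le hv)
  have hθ1 : v - ⌊v⌋₊ ≤ 1 := by linarith [Nat.lt_floor_add_one v]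
  have hG := gaussianField_disorderLaw
    (fun (p : Fin k) (i : Fin ((p : ℕ) + 1) → Fin n) =>
      √(v - ⌊v⌋₊) • t • glassVector (mixture Λ) a p i)
  -- The floor leaves a fractional clause with no counterpart on the CSP side. The Gaussian field of
  -- relative variance `v - ⌊v⌋₊ ≤ 1` is inserted for free-standing zero, at bounded cost.
  have h2 : Exchange (logSumExp U) (Measure.dirac 0) (disorderLaw fun (p : Fin k) i =>
      √(v - ⌊v⌋₊) • t • glassVector (mixture Λ) a p i) 0 (momentBound ℓ) := by
    refine exchange_dirac_zero hU hG.expMoments hG.mean fun x => ?_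
    have h3 := hG.integral_exp_abs_le 1 x
    simp only [one_mul] at h3
    refine h3.trans ?_
    unfold momentBound
    gcongr
    have h4 : ∑ p : Fin k, ∑ i, (√(v - ⌊v⌋₊) • t • glassVector (mixture Λ) a p i) x
        * (√(v - ⌊v⌋₊) • t • glassVector (mixture Λ) a p i) x
        = (v - ⌊v⌋₊) * t ^ 2 * ∑ p : Fin k, ∑ i,
          glassVector (mixture Λ) a p i x * glassVector (mixture Λ) a p i x := by
      rw [Finset.mul_sum]
      refine Finset.sum_congr rfl fun p _ => ?_
      rw [Finset.mul_sum]
      refine Finset.sum_congr rfl fun i _ => ?_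
      simp only [Pi.smul_apply, smul_eq_mul]
      nth_rewrite 3 [← Real.mul_self_sqrt hθ]
      ring
    rw [h4]
    have h5 := sum_glassVector_sq_le Λ ha x
    have h6 : (v - ⌊v⌋₊) * t ^ 2 ≤ 1 := mul_le_one₀ hθ1 (sq_nonneg _) (pow_le_one₀ ht ht1)
    have h7 : 0 ≤ (v - ⌊v⌋₊) * t ^ 2 := mul_nonneg hθ (sq_nonneg _)
    have h8 := mul_le_mul_of_nonneg_left h5 h7
    nlinarith [sq_nonneg (ℓ : ℝ)]
  have h3 := h1.conv hL h2
  have := h1.left.prob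
  rw [← disorderLaw_sqrt_add _ (Nat.cast_nonneg _) hθ, Measure.conv_dirac_zero,
    add_sub_cancel, add_zero] at h3
  exact h3

omit hU in
theorem varianceBound_clauses {a : Fin ℓ → ℝ} (ha : ∀ j, a j = 0 ∨ a j = 1) (t : ℝ) (m : ℕ) :
    VarianceBound ((Measure.pi fun _ : Fin m => clauseLaw Λ n).map
      fun E => ∑ e, t • clauseField a (E e)) (m * (t * ℓ) ^ 2) := by
  have hzero : VarianceBound (Measure.dirac (0 : (Fin ℓ → Config n) → ℝ)) 0 :=
    varianceBound_dirac_zero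
  have hconv : ∀ (μ ν : Measure ((Fin ℓ → Config n) → ℝ)) (c d : ℝ), VarianceBound μ c →
      VarianceBound ν d → VarianceBound (Measure.conv μ ν) (c + d) :=
    fun _ _ _ _ h h' => VarianceBound.conv h h'
  have hm : Measurable fun e : Clause k n => t • (clauseField a e : (Fin ℓ → Config n) → ℝ) :=
    (measurable_clauseField a).const_smul t
  have hb : ∀ e : Clause k n, ‖t • (clauseField a e : (Fin ℓ → Config n) → ℝ)‖ ≤ |t| * ℓ := by
    intro e
    rw [norm_smul, Real.norm_eq_abs]
    gcongr
    exact norm_clauseField_le ha e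
  have hbase : VarianceBound ((clauseLaw Λ n).map fun e =>
      t • (clauseField a e : (Fin ℓ → Config n) → ℝ)) ((t * ℓ) ^ 2) := by
    refine varianceBound_of_integral_sq_le (expMoments_map_of_le hm.aemeasurable _ hb) ?_
    rw [integral_map hm.aemeasurable (Continuous.aestronglyMeasurable (by fun_prop))]
    have h3 := norm_integral_le_of_norm_le_const (μ := clauseLaw Λ n) (C := (t * ℓ) ^ 2)
      (f := fun e => ‖t • (clauseField a e : (Fin ℓ → Config n) → ℝ)‖ ^ 2)
      (ae_of_all _ fun e => by
        rw [norm_pow, norm_norm, ← sq_abs (t * ℓ), abs_mul, Nat.abs_cast]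
        exact pow_le_pow_left₀ (norm_nonneg _) (hb e) 2)
    rw [probReal_univ, mul_one] at h3
    exact (le_abs_self _).trans h3
  have key := law_sum_induction_single VarianceBound hzero hconv
    (P := Measure.pi fun _ : Fin m => clauseLaw Λ n)
    (fun e E => t • (clauseField a (E e) : (Fin ℓ → Config n) → ℝ))
    (fun e => (hm.comp (measurable_pi_apply e)).aemeasurable)
    (iIndepFun_pi (X := fun _ e => t • (clauseField a e : (Fin ℓ → Config n) → ℝ))
      (fun _ => hm.aemeasurable))
    (fun _ => (t * ℓ) ^ 2) Finset.univ (fun e _ => by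
      have e1 : (Measure.pi fun _ : Fin m => clauseLaw Λ n).map
          (fun E => t • (clauseField a (E e) : (Fin ℓ → Config n) → ℝ))
          = (clauseLaw Λ n).map fun e => t • clauseField a e := by
        conv_rhs => rw [← (measurePreserving_eval (fun _ : Fin m => clauseLaw Λ n) e).map_eq,
          Measure.map_map hm (measurable_pi_apply e)]
        rfl
      rw [e1]
      exact hbase)
  simpa using key

omit hU in
-- At order `p + 1` there are `n ^ (p + 1)` coefficients, each with a squared norm of order `n ^
-- (-(p + 1))`, so the powers of `n` cancel.
theorem varianceBound_glass {a : Fin ℓ → ℝ} (ha : ∀ j, a j = 0 ∨ a j = 1) (t : ℝ) {v : ℝ}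
    (hv : 0 ≤ v) :
    VarianceBound (disorderLaw fun (p : Fin k) (i : Fin ((p : ℕ) + 1) → Fin n) =>
        √v • t • (glassVector (mixture Λ) a p i : (Fin ℓ → Config n) → ℝ))
      (v * ((t * ℓ) ^ 2 * ∑ p : Fin k, (mixture Λ).coeff ((p : ℕ) + 1))) := by
  have hn : (n : ℝ) ≠ 0 := NeZero.ne _
  have h := varianceBound_disorderLaw fun (p : Fin k) (i : Fin ((p : ℕ) + 1) → Fin n) =>
        √v • t • (glassVector (mixture Λ) a p i : (Fin ℓ → Config n) → ℝ)
  refine ⟨h.1, fun F hF => (h.2 F hF).trans ?_⟩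
  rw [Finset.mul_sum, Finset.mul_sum]
  refine Finset.sum_le_sum fun p _ => ?_
  calc _ ≤ ∑ _i : Fin ((p : ℕ) + 1) → Fin n, v * t ^ 2 *
        ((mixture Λ).coeff ((p : ℕ) + 1) / (n : ℝ) ^ ((p : ℕ) + 1) * (ℓ : ℝ) ^ 2) := by
        refine Finset.sum_le_sum fun i _ => ?_
        rw [norm_smul, norm_smul, mul_pow, mul_pow, Real.norm_eq_abs, Real.norm_eq_abs, sq_abs,
          sq_abs, Real.sq_sqrt hv, ← mul_assoc]
        gcongr
        exact norm_glassVector_sq_le (coeff_mixture_nonneg Λ _) ha i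
    _ = _ := by
        simp
        field_simp

end Column

end CSPGlass

/-! ### Coupled models -/

namespace CSPGlass

/-! ### The hidden models as laws of clause fields and glass fields -/

section Laws

variable {k ℓ n : ℕ}

theorem measurable_cspHamiltonian {m : ℕ} (α : ℝ) :
    Measurable (cspHamiltonian α : (Fin m → Clause k n) → Hamiltonian n) := by
  refine measurable_pi_lambda _ fun σ => ?_
  unfold cspHamiltonian
  exact (Finset.measurable_sum _ fun e _ =>
    (measurable_value σ).comp (measurable_pi_apply e)).const_mul _

theorem measurable_sgHamiltonian (ξ : Polynomial ℝ) :
    Measurable (sgHamiltonian ξ : Disorder k n → Hamiltonian n) := by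
  unfold sgHamiltonian
  fun_prop

theorem measurable_smul_tupleField (c : ℝ) (a : Fin ℓ → ℝ) :
    Measurable fun h : Hamiltonian n => c • tupleField a h :=
  (measurable_tupleField a).const_smul c

theorem map_cspLaw (Λ : Measure (Predicate k)) (α β b : ℝ) (a : Fin ℓ → ℝ) :
    (cspLaw Λ α b n).map (fun h => β • tupleField a h)
      = (Measure.pi fun _ : Fin ⌊b * α * n⌋₊ => clauseLaw Λ n).map
        fun E => ∑ e, (β / α) • clauseField a (E e) := by
  unfold cspLaw
  rw [Measure.map_map (measurable_smul_tupleField β a) (measurable_cspHamiltonian α)]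
  congr 1
  ext E x
  simp only [Function.comp, Pi.smul_apply, Finset.sum_apply, smul_eq_mul, tupleField,
    cspHamiltonian, clauseField, Finset.mul_sum]
  rw [Finset.sum_comm]
  refine Finset.sum_congr rfl fun e _ => Finset.sum_congr rfl fun j _ => ?_
  ring

/-- The glass vectors carry `n ^ (-(p + 1) / 2)` rather than `n ^ (-p / 2)`; the missing `√n` and
the inverse temperature come from `√(b α n) · β / α = √(b n) · β / √α`. This is where the rescaled
temperature `β / √α` arises. -/
theorem map_sgLaw [NeZero n] (ξ : Polynomial ℝ) {α : ℝ} (hα : 0 < α) (β : ℝ) {b : ℝ} (hb : 0 ≤ b)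
    (a : Fin ℓ → ℝ) :
    (sgLaw k (Polynomial.C b * ξ) n).map (fun h => (β / √α) • tupleField a h)
      = disorderLaw fun (p : Fin k) i => √(b * α * n) • (β / α) • glassVector ξ a p i := by
  have hn : (0 : ℝ) < n := by exact_mod_cast Nat.pos_of_ne_zero (NeZero.ne n)
  unfold sgLaw disorderLaw
  rw [Measure.map_map (measurable_smul_tupleField _ a) (measurable_sgHamiltonian _)]
  congr 1
  ext J x
  simp only [Function.comp, Pi.smul_apply, Finset.sum_apply, smul_eq_mul, tupleField,
    sgHamiltonian, glassVector, Finset.mul_sum]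
  rw [Finset.sum_comm]
  refine Finset.sum_congr rfl fun p _ => ?_
  rw [Finset.sum_comm]
  refine Finset.sum_congr rfl fun i _ => Finset.sum_congr rfl fun j _ => ?_
  have h1 : √α ≠ 0 := (Real.sqrt_pos.2 hα).ne'
  have h2 : √(n : ℝ) ≠ 0 := (Real.sqrt_pos.2 hn).ne'
  have h3 : √((n : ℝ) ^ (p : ℕ)) ≠ 0 := (Real.sqrt_pos.2 (pow_pos hn _)).ne'
  have h4 : α = √α * √α := (Real.mul_self_sqrt hα.le).symm
  rw [Polynomial.coeff_C_mul, Real.sqrt_mul hb, Real.sqrt_mul (by positivity),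
    Real.sqrt_mul hb, pow_succ, Real.sqrt_mul (by positivity)]
  have h5 : β / α = β / (√α * √α) := by rw [← h4]
  rw [h5]
  field_simp

end Laws

/-! ### Summation over hidden instances and free energy estimates -/

section Coupled

variable {k ℓ ℓ' n : ℕ} {A : Matrix (Fin ℓ) (Fin ℓ') ℝ} {b : Fin ℓ' → ℝ}

/-- A coupled grand Hamiltonian is a sum over the hidden instances. -/
theorem smul_grand_eq_sum {H : Fin ℓ → Hamiltonian n} {H' : Fin ℓ' → Hamiltonian n}
    (h : ∀ i σ, H i σ = ∑ i', A i i' * H' i' σ) (β : ℝ) :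
    β • grand H = ∑ i', β • tupleField (fun j => A j i') (H' i') := by
  ext x
  simp only [Pi.smul_apply, smul_eq_mul, grand, h, Finset.sum_apply, tupleField, Finset.mul_sum]
  rw [Finset.sum_comm]

/-- Counting by rows, each of the `ℓ` rows of `A b` contributes `1`. This keeps the total exchange
error independent of the coupling. -/
theorem IsCoupling.sum_mul (hA : IsCoupling A b) : ∑ i', b i' * ∑ j, A j i' = ℓ := by
  simp_rw [Finset.mul_sum]
  rw [Finset.sum_comm]
  have h : ∀ j, ∑ i', b i' * A j i' = 1 := fun j => by
    rw [← hA.mulVec_eq_one j, Matrix.mulVec, dotProduct]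
    exact Finset.sum_congr rfl fun i' _ => mul_comm _ _
  simp [h]

theorem map_smul_tupleField_of_hasLaw {Ω : Type*} [MeasurableSpace Ω] {P : Measure Ω} {μ : Measure (Hamiltonian n)}
    {H' : Ω → Hamiltonian n} (h : HasLaw H' μ P) (β : ℝ) (a : Fin ℓ → ℝ) :
    P.map (fun ω => β • tupleField a (H' ω)) = μ.map fun h => β • tupleField a h := by
  rw [← h.map_eq, AEMeasurable.map_map_of_aemeasurable (measurable_smul_tupleField β a).aemeasurable h.aemeasurable]
  rfl

variable (Λ : Measure (Predicate k)) [IsProbabilityMeasure Λ] [NeZero n]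

/-- The comparison of the coupled random CSP with the coupled spin glass, and the concentration of
both, in terms of the laws of their grand Hamiltonians. -/
theorem exchange_grand (hA : IsCoupling A b) {α β : ℝ} (hα : 0 < α) (hβ : 0 < β)
    (hβα : β / α ≤ 1) {Ω : Type*} [MeasurableSpace Ω] {P : Measure Ω} [IsProbabilityMeasure P]
    {H G : Fin ℓ → Ω → Hamiltonian n} (hH : IsCoupledCSP Λ α A b P H)
    (hG : IsCoupledSG k (mixture Λ) A b P G) {U : Finset (Fin ℓ → Config n)} (hU : U.Nonempty) :
    AEMeasurable (fun ω => β • grand fun i => H i ω) P ∧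
    AEMeasurable (fun ω => (β / √α) • grand fun i => G i ω) P ∧
    Exchange (logSumExp U) (P.map fun ω => β • grand fun i => H i ω)
      (P.map fun ω => (β / √α) • grand fun i => G i ω)
      (∑ i', ⌊b i' * α * n⌋₊ * (β / α * ((∑ j, A j i') * meanValue Λ)))
      (∑ i', (⌊b i' * α * n⌋₊ * (20 * momentBound ℓ * (β / α) ^ 3 * ∑ j, A j i')
        + momentBound ℓ)) ∧
    VarianceBound (P.map fun ω => β • grand fun i => H i ω)
      (∑ i', ⌊b i' * α * n⌋₊ * (β / α * ℓ) ^ 2) ∧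
    VarianceBound (P.map fun ω => (β / √α) • grand fun i => G i ω)
      (∑ i', b i' * α * n * ((β / α * ℓ) ^ 2
        * ∑ p : Fin k, (mixture Λ).coeff ((p : ℕ) + 1))) := by
  obtain ⟨H', hH1, hH2, hH3⟩ := hH
  obtain ⟨G', hG1, hG2, hG3⟩ := hG
  have ht : 0 ≤ β / α := by positivity
  have ha : ∀ i' j, A j i' = 0 ∨ A j i' = 1 := fun i' j => hA.zero_or_one j i'
  have hb : ∀ i', 0 ≤ b i' := hA.nonneg
  have hv : ∀ i', 0 ≤ b i' * α * n := fun i' => by have := hb i'; positivity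
  have hm : ∀ (c : ℝ) (i' : Fin ℓ'),
      Measurable fun h : Hamiltonian n => c • tupleField (fun j => A j i') h :=
    fun c i' => measurable_smul_tupleField c _
  have eH : (fun ω => β • grand fun i => H i ω)
      = fun ω => ∑ i', β • tupleField (fun j => A j i') (H' i' ω) := by
    funext ω; exact smul_grand_eq_sum (fun i σ => hH3 i ω σ) β
  have eG : (fun ω => (β / √α) • grand fun i => G i ω)
      = fun ω => ∑ i', (β / √α) • tupleField (fun j => A j i') (G' i' ω) := by
    funext ω; exact smul_grand_eq_sum (fun i σ => hG3 i ω σ) _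
  rw [eH, eG]
  have mH : ∀ i', AEMeasurable (fun ω => β • tupleField (fun j => A j i') (H' i' ω)) P :=
    fun i' => (hm β i').comp_aemeasurable (hH1 i').aemeasurable
  have mG : ∀ i', AEMeasurable (fun ω => (β / √α) • tupleField (fun j => A j i') (G' i' ω)) P :=
    fun i' => (hm _ i').comp_aemeasurable (hG1 i').aemeasurable
  have iH : iIndepFun (fun i' ω => β • tupleField (fun j => A j i') (H' i' ω)) P :=
    hH2.comp (fun i' h => β • tupleField (fun j => A j i') h) (hm β)
  have iG : iIndepFun (fun i' ω => (β / √α) • tupleField (fun j => A j i') (G' i' ω)) P :=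
    hG2.comp (fun i' h => (β / √α) • tupleField (fun j => A j i') h) (hm _)
  have lH : ∀ i', P.map (fun ω => β • tupleField (fun j => A j i') (H' i' ω))
      = (Measure.pi fun _ : Fin ⌊b i' * α * n⌋₊ => clauseLaw Λ n).map
        fun E => ∑ e, (β / α) • clauseField (fun j => A j i') (E e) := fun i' => by
    rw [map_smul_tupleField_of_hasLaw (hH1 i'), map_cspLaw]
  have lG : ∀ i', P.map (fun ω => (β / √α) • tupleField (fun j => A j i') (G' i' ω))
      = disorderLaw fun (p : Fin k) i => √(b i' * α * n) • (β / α) •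
        glassVector (mixture Λ) (fun j => A j i') p i := fun i' => by
    rw [map_smul_tupleField_of_hasLaw (hG1 i'), map_sgLaw _ hα _ (hb i')]
  have hL := lipschitz_logSumExp hU
  have vconv : ∀ (μ ν : Measure ((Fin ℓ → Config n) → ℝ)) (c d : ℝ), VarianceBound μ c →
      VarianceBound ν d → VarianceBound (Measure.conv μ ν) (c + d) :=
    fun _ _ _ _ h h' => VarianceBound.conv h h'
  have vzero : VarianceBound (Measure.dirac (0 : (Fin ℓ → Config n) → ℝ)) 0 :=
    varianceBound_dirac_zero
  refine ⟨Finset.aemeasurable_fun_sum _ fun i' _ => mH i',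
    Finset.aemeasurable_fun_sum _ fun i' _ => mG i', ?_, ?_, ?_⟩
  · let r : (Bool → Measure ((Fin ℓ → Config n) → ℝ)) → ℝ × ℝ → Prop :=
      fun μ q => Exchange (logSumExp U) (μ true) (μ false) q.1 q.2
    have rzero : r (fun _ => Measure.dirac 0) 0 := Exchange.refl _ (expMoments_dirac 0)
    have rconv : ∀ μ ν c d, r μ c → r ν d → r (fun a => Measure.conv (μ a) (ν a)) (c + d) :=
      fun _ _ _ _ h h' => Exchange.conv hL h h'
    have key := law_sum_induction r rzero rconv (P := P)
      (fun a i' ω => cond a (β • tupleField (fun j => A j i') (H' i' ω))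
        ((β / √α) • tupleField (fun j => A j i') (G' i' ω)))
      (fun a i' => by cases a; exacts [mG i', mH i'])
      (fun a => by cases a; exacts [iG, iH])
      (fun i' => (⌊b i' * α * n⌋₊ * (β / α * ((∑ j, A j i') * meanValue Λ)),
        ⌊b i' * α * n⌋₊ * (20 * momentBound ℓ * (β / α) ^ 3 * ∑ j, A j i') + momentBound ℓ))
      Finset.univ (fun i' _ => by
        have h := exchange_instance Λ hU (ha i') ht hβα (hv i')
        rw [← lH i', ← lG i'] at h
        exact h)
    simp only [r, Prod.fst_sum, Prod.snd_sum] at key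
    exact key
  · refine law_sum_induction_single VarianceBound vzero vconv _ mH iH _ _ fun i' _ => ?_
    have h := varianceBound_clauses (n := n) Λ (ha i') (β / α) ⌊b i' * α * n⌋₊
    rw [← lH i'] at h
    exact h
  · refine law_sum_induction_single VarianceBound vzero vconv _ mG iG _ _ fun i' _ => ?_
    have h := varianceBound_glass (n := n) Λ (ha i') (β / α) (hv i')
    rw [← lG i'] at h
    exact h

theorem abs_meanValue_le : |meanValue Λ| ≤ 1 := by
  have h := norm_integral_le_of_norm_le_const (μ := Λ) (C := 1)
    (f := fun f => fourierCoeff f ∅) (ae_of_all _ fun f => abs_fourierCoeff_le f ∅)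
  unfold meanValue
  simpa using h

open Classical in
/-- The tuples of configurations with overlap vector in `S`, as a finite set. -/
noncomputable def tupleFinset (ℓ n : ℕ) (S : Set (Finset (Fin ℓ) → ℝ)) :
    Finset (Fin ℓ → Config n) :=
  Finset.univ.filter fun x => x ∈ overlapPreimage n S

theorem tupleFinset_nonempty {S : Set (Finset (Fin ℓ) → ℝ)} (h : (overlapPreimage n S).Nonempty) :
    (tupleFinset ℓ n S).Nonempty := by
  obtain ⟨x, hx⟩ := h
  exact ⟨x, by simpa [tupleFinset] using hx⟩

theorem freeEnergyDensity_eq (S : Set (Finset (Fin ℓ) → ℝ)) (β : ℝ) (K : (Fin ℓ → Config n) → ℝ) :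
    freeEnergyDensity S β K = 1 / (β * ℓ * n) * logSumExp (tupleFinset ℓ n S) (β • K) := rfl

theorem variance_freeEnergyDensity_le {Ω : Type*} [MeasurableSpace Ω] {P : Measure Ω}
    [IsProbabilityMeasure P] {S : Set (Finset (Fin ℓ) → ℝ)} (hS : (overlapPreimage n S).Nonempty)
    {β c : ℝ} {K : Ω → (Fin ℓ → Config n) → ℝ} (hK : AEMeasurable (fun ω => β • K ω) P)
    (h : VarianceBound (P.map fun ω => β • K ω) c) :
    MemLp (fun ω => freeEnergyDensity S β (K ω)) 2 P ∧
      Var[fun ω => freeEnergyDensity S β (K ω); P] ≤ (1 / (β * ℓ * n)) ^ 2 * c := by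
  have hL := lipschitz_logSumExp (tupleFinset_nonempty hS)
  simp_rw [freeEnergyDensity_eq]
  constructor
  · have h1 := (h.1.memLp_lipschitz hL).comp_of_map hK
    exact h1.const_mul _
  · rw [variance_const_mul]
    refine mul_le_mul_of_nonneg_left ?_ (sq_nonneg _)
    have h1 := variance_map (hL.continuous.measurable.aemeasurable
      (μ := P.map fun ω => β • K ω)) hK
    exact h1.symm.trans_le (h.2 _ hL)

/-- The free energy estimates at a fixed number of variables. -/
theorem freeEnergyDensity_estimates (hℓ : 0 < ℓ) (hA : IsCoupling A b) {α β : ℝ} (hα : 0 < α)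
    (hβ : 0 < β) (hβα : β / α ≤ 1) {Ω : Type*} [MeasurableSpace Ω] {P : Measure Ω}
    [IsProbabilityMeasure P]
    {H G : Fin ℓ → Ω → Hamiltonian n} (hH : IsCoupledCSP Λ α A b P H)
    (hG : IsCoupledSG k (mixture Λ) A b P G) {S : Set (Finset (Fin ℓ) → ℝ)}
    (hS : (overlapPreimage n S).Nonempty) :
    MemLp (fun ω => freeEnergyDensity S β (grand fun i => H i ω)) 2 P ∧
    MemLp (fun ω => freeEnergyDensity S (β / √α) (grand fun i => G i ω)) 2 P ∧
    |∫ ω, freeEnergyDensity S β (grand fun i => H i ω) ∂P - (meanValue Λ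
      + 1 / √α * ∫ ω, freeEnergyDensity S (β / √α) (grand fun i => G i ω) ∂P)|
      ≤ 20 * momentBound ℓ * (β ^ 2 / α ^ 2)
        + (ℓ' * (momentBound ℓ + β / α * ℓ)) / (β * ℓ) * (1 / n) ∧
    Var[fun ω => freeEnergyDensity S β (grand fun i => H i ω); P]
      ≤ (∑ i', b i' / α) * (1 / n) ∧
    Var[fun ω => freeEnergyDensity S (β / √α) (grand fun i => G i ω); P]
      ≤ (∑ i', b i' * ∑ p : Fin k, (mixture Λ).coeff ((p : ℕ) + 1)) * (1 / n) := by
  have hn : (0 : ℝ) < n := by exact_mod_cast Nat.pos_of_ne_zero (NeZero.ne n)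
  have hl : (0 : ℝ) < ℓ := by exact_mod_cast hℓ
  have hsα : 0 < √α := Real.sqrt_pos.2 hα
  have hsα2 : √α ^ 2 = α := Real.sq_sqrt hα.le
  have hK := momentBound_pos ℓ
  obtain ⟨mW, mZ, hex, vW, vZ⟩ := exchange_grand Λ hA hα hβ hβα hH hG (tupleFinset_nonempty hS)
  obtain ⟨lW, vW'⟩ := variance_freeEnergyDensity_le hS mW vW
  obtain ⟨lZ, vZ'⟩ := variance_freeEnergyDensity_le hS mZ vZ
  have hs0 : ∀ i', 0 ≤ ∑ j, A j i' := fun i' => Finset.sum_nonneg fun j _ => by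
    rcases hA.zero_or_one j i' with h | h <;> simp [h]
  have hsl : ∀ i', ∑ j, A j i' ≤ ℓ := fun i' => by
    calc ∑ j, A j i' ≤ ∑ _j : Fin ℓ, (1 : ℝ) := Finset.sum_le_sum fun j _ => by
          rcases hA.zero_or_one j i' with h | h <;> simp [h]
      _ = ℓ := by simp
  have hv : ∀ i', 0 ≤ b i' * α * n := fun i' => by have := hA.nonneg i'; positivity
  have hfl : ∀ i', (⌊b i' * α * n⌋₊ : ℝ) ≤ b i' * α * n := fun i' => Nat.floor_le (hv i')
  have hfl' : ∀ i', b i' * α * n - 1 ≤ (⌊b i' * α * n⌋₊ : ℝ) := fun i' => by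
    linarith [Nat.lt_floor_add_one (b i' * α * n)]
  have hsum : ∑ i', b i' * α * n * ∑ j, A j i' = ℓ * α * n := by
    rw [← hA.sum_mul, Finset.sum_mul, Finset.sum_mul]
    exact Finset.sum_congr rfl fun i' _ => by ring
  refine ⟨lW, lZ, ?_, vW'.trans ?_, vZ'.trans ?_⟩
  · have hL := lipschitz_logSumExp (tupleFinset_nonempty hS)
    have h := hex.bound 0
    simp only [zero_add] at h
    rw [integral_map mW hL.continuous.aestronglyMeasurable,
      integral_map mZ hL.continuous.aestronglyMeasurable] at h
    simp_rw [freeEnergyDensity_eq, integral_const_mul]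
    set I := ∫ ω, logSumExp (tupleFinset ℓ n S) (β • grand fun i => H i ω) ∂P
    set J := ∫ ω, logSumExp (tupleFinset ℓ n S) ((β / √α) • grand fun i => G i ω) ∂P
    set F := ∑ i', (⌊b i' * α * n⌋₊ : ℝ) * ∑ j, A j i' with hF
    have hF1 : F ≤ ℓ * α * n := by
      rw [← hsum]
      exact Finset.sum_le_sum fun i' _ => mul_le_mul_of_nonneg_right (hfl i') (hs0 i')
    -- Each of the `ℓ'` floors loses at most one clause, and a clause has weight at most `ℓ`.
    have hF2 : ℓ * α * n - ℓ' * ℓ ≤ F := by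
      have : ∑ i', ((b i' * α * n) * ∑ j, A j i' - ℓ) ≤ F := Finset.sum_le_sum fun i' _ => by
        nlinarith [mul_le_mul_of_nonneg_right (hfl' i') (hs0 i'), hsl i']
      rw [Finset.sum_sub_distrib, hsum] at this
      simpa using this
    have e1 : ∑ i', ⌊b i' * α * n⌋₊ * (β / α * ((∑ j, A j i') * meanValue Λ))
        = β / α * meanValue Λ * F := by
      rw [hF, Finset.mul_sum]
      exact Finset.sum_congr rfl fun i' _ => by ring
    have e2 : ∑ i', (⌊b i' * α * n⌋₊ * (20 * momentBound ℓ * (β / α) ^ 3 * ∑ j, A j i')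
        + momentBound ℓ) = 20 * momentBound ℓ * (β / α) ^ 3 * F + ℓ' * momentBound ℓ := by
      rw [Finset.sum_add_distrib, hF, Finset.mul_sum]
      congr 1
      · exact Finset.sum_congr rfl fun i' _ => by ring
      · simp
    rw [e1, e2] at h
    have h2 : |β / α * meanValue Λ * F - β * ℓ * n * meanValue Λ| ≤ β / α * (ℓ' * ℓ) := by
      have e3 : β / α * meanValue Λ * F - β * ℓ * n * meanValue Λ
          = β / α * (meanValue Λ * (F - ℓ * α * n)) := by field_simp
      rw [e3, abs_mul, abs_of_nonneg (by positivity : 0 ≤ β / α), abs_mul]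
      refine mul_le_mul_of_nonneg_left ?_ (by positivity)
      calc |meanValue Λ| * |F - ℓ * α * n| ≤ 1 * (ℓ' * ℓ) := by
            gcongr
            · exact abs_meanValue_le Λ
            · rw [abs_le]
              constructor <;> nlinarith
        _ = _ := one_mul _
    have h3 : |I - β * ℓ * n * meanValue Λ - J|
        ≤ 20 * momentBound ℓ * (β / α) ^ 3 * (ℓ * α * n)
          + ℓ' * (momentBound ℓ + β / α * ℓ) := by
      have h4 : 20 * momentBound ℓ * (β / α) ^ 3 * F
          ≤ 20 * momentBound ℓ * (β / α) ^ 3 * (ℓ * α * n) := by gcongr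
      have h5 := abs_add_le (I - β / α * meanValue Λ * F - J)
        (β / α * meanValue Λ * F - β * ℓ * n * meanValue Λ)
      have e4 : I - β / α * meanValue Λ * F - J
        + (β / α * meanValue Λ * F - β * ℓ * n * meanValue Λ)
        = I - β * ℓ * n * meanValue Λ - J := by ring
      rw [e4] at h5
      linarith
    -- The prefactor `1 / √α` in front of the glass free energy turns its normalization `β / √α`
    -- into `β`, so both sides share the factor `1 / (β ℓ n)`.
    have e5 : 1 / (β * ℓ * n) * I - (meanValue Λ + 1 / √α * (1 / (β / √α * ℓ * n) * J))
        = 1 / (β * ℓ * n) * (I - β * ℓ * n * meanValue Λ - J) := by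
      field_simp
      ring
    rw [e5, abs_mul, abs_of_nonneg (by positivity : 0 ≤ 1 / (β * ℓ * n))]
    refine (mul_le_mul_of_nonneg_left h3 (by positivity)).trans (le_of_eq ?_)
    field_simp
  · calc _ ≤ (1 / (β * ℓ * n)) ^ 2 * ∑ i', b i' * α * n * (β / α * ℓ) ^ 2 := by
          gcongr with i'
          exact hfl i'
      _ = _ := by
          rw [Finset.mul_sum, Finset.sum_mul]
          refine Finset.sum_congr rfl fun i' _ => ?_
          field_simp
  · rw [Finset.mul_sum, Finset.sum_mul]
    refine le_of_eq (Finset.sum_congr rfl fun i' _ => ?_)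
    rw [one_div, inv_pow, mul_pow, mul_pow, div_pow, hsα2]
    field_simp

end Coupled

end CSPGlass

/-! ### The comparison theorem -/

theorem theorem3 (ℓ : ℕ) (hℓ : 0 < ℓ) :
    ∃ C : ℝ, 0 < C ∧ ∃ ε₀ : ℝ, 0 < ε₀ ∧
      ∀ (k : ℕ) (Λ : Measure (CSPGlass.Predicate k)) [IsProbabilityMeasure Λ]
        (ℓ' : ℕ) (A : Matrix (Fin ℓ) (Fin ℓ') ℝ) (b : Fin ℓ' → ℝ),
      CSPGlass.IsCoupling A b →
      ∀ (S : Set (Finset (Fin ℓ) → ℝ)), S ⊆ CSPGlass.overlapPolytope ℓ →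
      ∀ α β : ℝ, 0 < α → 0 < β → β / α ≤ ε₀ →
      ∀ (Ω : ℕ → Type*) [∀ n, MeasurableSpace (Ω n)] (P : (n : ℕ) → Measure (Ω n))
        [∀ n, IsProbabilityMeasure (P n)]
        (H G : (n : ℕ) → Fin ℓ → Ω n → CSPGlass.Hamiltonian n),
      (∀ n, 0 < n → CSPGlass.IsCoupledCSP Λ α A b (P n) (H n)) →
      (∀ n, 0 < n → CSPGlass.IsCoupledSG k (CSPGlass.mixture Λ) A b (P n) (G n)) →
      ∃ e : ℕ → ℝ, (∀ n, |e n| ≤ C * (β ^ 2 / α ^ 2)) ∧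
        -- the statement in expectation
        (∃ o : ℕ → ℝ, Tendsto o atTop (𝓝 0) ∧
          ∀ n, 0 < n → (CSPGlass.overlapPreimage n S).Nonempty →
            Integrable (fun ω => CSPGlass.freeEnergyDensity S β
              (CSPGlass.grand fun i => H n i ω)) (P n) ∧
            Integrable (fun ω => CSPGlass.freeEnergyDensity S (β / √α)
              (CSPGlass.grand fun i => G n i ω)) (P n) ∧
            ∫ ω, CSPGlass.freeEnergyDensity S β (CSPGlass.grand fun i => H n i ω) ∂(P n)
              = CSPGlass.meanValue Λ
                + 1 / √α * ∫ ω, CSPGlass.freeEnergyDensity S (β / √α)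
                    (CSPGlass.grand fun i => G n i ω) ∂(P n)
                + e n + o n) ∧
        -- the statement without expectations, with high probability
        (∃ δ η : ℕ → ℝ, Tendsto δ atTop (𝓝 0) ∧ Tendsto η atTop (𝓝 0) ∧
          ∀ n, 0 < n → (CSPGlass.overlapPreimage n S).Nonempty →
            1 - η n ≤ (P n).real {ω |
              |CSPGlass.freeEnergyDensity S β (CSPGlass.grand fun i => H n i ω)
                - (CSPGlass.meanValue Λ
                  + 1 / √α * CSPGlass.freeEnergyDensity S (β / √α)
                      (CSPGlass.grand fun i => G n i ω)
                  + e n)| ≤ δ n}) := by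
  
  -- The threshold `ε₀ = 1` suffices, since the expansion only needs `β / α ≤ 1`.
  refine ⟨20 * CSPGlass.momentBound ℓ, by have := CSPGlass.momentBound_pos ℓ; positivity, 1,
    one_pos, ?_⟩
  intro k Λ _ ℓ' A b hA S _ α β hα hβ hβα Ω _ P _ H G hH hG
  have hC : 0 ≤ 20 * CSPGlass.momentBound ℓ * (β ^ 2 / α ^ 2) := by
    have := CSPGlass.momentBound_pos ℓ; positivity
  set C := 20 * CSPGlass.momentBound ℓ * (β ^ 2 / α ^ 2)
  set X : (n : ℕ) → Ω n → ℝ := fun n ω =>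
    CSPGlass.freeEnergyDensity S β (CSPGlass.grand fun i => H n i ω)
  set Y : (n : ℕ) → Ω n → ℝ := fun n ω =>
    CSPGlass.freeEnergyDensity S (β / √α) (CSPGlass.grand fun i => G n i ω)
  obtain ⟨K₀, V₁, V₂, hmain⟩ : ∃ K₀ V₁ V₂ : ℝ, ∀ n, 0 < n →
      (CSPGlass.overlapPreimage n S).Nonempty → MemLp (X n) 2 (P n) ∧ MemLp (Y n) 2 (P n) ∧
      |∫ ω, X n ω ∂(P n) - (CSPGlass.meanValue Λ + 1 / √α * ∫ ω, Y n ω ∂(P n))|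
        ≤ C + K₀ * (1 / n) ∧
      Var[X n; P n] ≤ V₁ * (1 / n) ∧ Var[Y n; P n] ≤ V₂ * (1 / n) := by
    refine ⟨ℓ' * (CSPGlass.momentBound ℓ + β / α * ℓ) / (β * ℓ), ∑ i', b i' / α,
      ∑ i', b i' * ∑ p : Fin k, (CSPGlass.mixture Λ).coeff ((p : ℕ) + 1), fun n hn hS => ?_⟩
    have : NeZero n := ⟨hn.ne'⟩
    exact CSPGlass.freeEnergyDensity_estimates Λ hℓ hA hα hβ hβα (hH n hn) (hG n hn) hS
  have hsα : 0 < √α := Real.sqrt_pos.2 hα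
  set d : ℕ → ℝ := fun n =>
    ∫ ω, X n ω ∂(P n) - (CSPGlass.meanValue Λ + 1 / √α * ∫ ω, Y n ω ∂(P n)) with hd
  have hinv : Tendsto (fun n : ℕ => 1 / (n : ℝ)) atTop (𝓝 0) := tendsto_one_div_atTop_nhds_zero_nat
  have hsqrt : Tendsto (fun n : ℕ => √(1 / (n : ℝ))) atTop (𝓝 0) := by
    simpa only [Real.sqrt_zero, Function.comp_def] using (Real.continuous_sqrt.tendsto 0).comp hinv
  have hsqrt2 : Tendsto (fun n : ℕ => √√(1 / (n : ℝ))) atTop (𝓝 0) := by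
    simpa only [Real.sqrt_zero, Function.comp_def] using (Real.continuous_sqrt.tendsto 0).comp hsqrt
  obtain ⟨e, he, o, ho, heo⟩ : ∃ e : ℕ → ℝ, (∀ n, |e n| ≤ C) ∧ ∃ o : ℕ → ℝ,
      Tendsto o atTop (𝓝 0) ∧ ∀ n, 0 < n → (CSPGlass.overlapPreimage n S).Nonempty →
        d n = e n + o n := by
    classical
    -- The error `e` is the truncation of the discrepancy `d` to `[-C, C]`, and `o` is the
    -- overshoot, at most `|K₀| / n`. Where no estimate is available, `o` is set to `0`.
    refine ⟨fun n => max (-C) (min C (d n)), fun n => ?_, fun n =>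
      if 0 < n ∧ (CSPGlass.overlapPreimage n S).Nonempty then d n - max (-C) (min C (d n)) else 0,
      ?_, fun n hn hS => ?_⟩
    · rw [abs_le]
      exact ⟨le_max_left _ _, max_le (by linarith) (min_le_left _ _)⟩
    · have hlim : Tendsto (fun n : ℕ => |K₀| * (1 / (n : ℝ))) atTop (𝓝 0) := by
        simpa using hinv.const_mul |K₀|
      refine squeeze_zero_norm (fun n => ?_) hlim
      have hn0 : (0 : ℝ) ≤ 1 / (n : ℝ) := by positivity
      have hK₀ : 0 ≤ |K₀| * (1 / (n : ℝ)) := by positivity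
      split_ifs with h
      · have h1 : |d n| ≤ C + K₀ * (1 / n) := (hmain n h.1 h.2).2.2.1
        have h2 : K₀ * (1 / (n : ℝ)) ≤ |K₀| * (1 / n) :=
          mul_le_mul_of_nonneg_right (le_abs_self _) hn0
        rw [Real.norm_eq_abs]
        rw [abs_le] at h1 ⊢
        rcases le_total C (d n) with h3 | h3
        · rw [min_eq_left h3, max_eq_right (by linarith)]
          constructor <;> linarith
        · rw [min_eq_right h3]
          rcases le_total (-C) (d n) with h4 | h4
          · rw [max_eq_right h4]
            constructor <;> linarith
          · rw [max_eq_left h4]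
            constructor <;> linarith
      · simpa using hK₀
    · simp only
      rw [if_pos ⟨hn, hS⟩]
      ring
  refine ⟨e, he, ⟨o, ho, fun n hn hS => ?_⟩, ?_⟩
  · obtain ⟨mX, mY, -⟩ := hmain n hn hS
    refine ⟨mX.integrable one_le_two, mY.integrable one_le_two, ?_⟩
    have h := heo n hn hS
    simp only [hd] at h
    linarith
  -- Deviations of size `n ^ (-1/4)` against variances `O(1/n)` give, by Chebyshev, failure
  -- probabilities of order `n ^ (-1/2)`. The threshold for `Y` is larger by `√α`, to compensate for
  -- its prefactor `1 / √α`.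
  · refine ⟨fun n => |o n| + 2 * √√(1 / (n : ℝ)), fun n => (V₁ + V₂ / α) * √(1 / (n : ℝ)), ?_, ?_,
      fun n hn hS => ?_⟩
    · simpa using ho.abs.add (hsqrt2.const_mul 2)
    · simpa using hsqrt.const_mul (V₁ + V₂ / α)
    obtain ⟨mX, mY, -, vX, vY⟩ := hmain n hn hS
    have hn' : (0 : ℝ) < 1 / (n : ℝ) := by positivity
    set q := √(1 / (n : ℝ)) with hq
    have hq0 : 0 < q := Real.sqrt_pos.2 hn'
    have hq2 : 1 / (n : ℝ) = q * q := (Real.mul_self_sqrt hn'.le).symm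
    have hr0 : 0 < √q := Real.sqrt_pos.2 hq0
    have hr2 : √q ^ 2 = q := Real.sq_sqrt hq0.le
    have tail : ∀ {Z : Ω n → ℝ} {V c s : ℝ}, MemLp Z 2 (P n) → Var[Z; P n] ≤ V * (1 / n) →
        0 < c → c ^ 2 = s * q → 0 < s →
        (P n).real {ω | c ≤ |Z ω - ∫ ω, Z ω ∂(P n)|} ≤ V / s * q := by
      intro Z V c s hZ hV hc hcs hs
      have h1 := meas_ge_le_variance_div_sq hZ hc
      have h2 : Var[Z; P n] / c ^ 2 ≤ V / s * q := by
        rw [hcs, div_le_iff₀ (by positivity)]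
        refine hV.trans (le_of_eq ?_)
        rw [hq2]
        field_simp
      have h3 : 0 ≤ Var[Z; P n] / c ^ 2 := div_nonneg (variance_nonneg _ _) (sq_nonneg _)
      exact (ENNReal.toReal_le_of_le_ofReal h3 h1).trans h2
    have t1 := tail mX vX hr0 (by rw [hr2, one_mul]) one_pos
    have t2 := tail (c := √α * √q) (s := α) mY vY (by positivity)
      (by rw [mul_pow, hr2, Real.sq_sqrt hα.le]) hα
    -- Covering the whole space by the good event and the two deviation events bounds the good
    -- probability from below by subadditivity alone, without measurability of the events or any
    -- assumption on the joint law.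
    have hcover : (Set.univ : Set (Ω n)) ⊆ {ω | |X n ω - (CSPGlass.meanValue Λ
          + 1 / √α * Y n ω + e n)| ≤ |o n| + 2 * √q}
        ∪ ({ω | √q ≤ |X n ω - ∫ ω, X n ω ∂(P n)|}
          ∪ {ω | √α * √q ≤ |Y n ω - ∫ ω, Y n ω ∂(P n)|}) := by
      intro ω _
      by_contra hcon
      simp only [Set.mem_union, Set.mem_ofPred_eq, not_or, not_le] at hcon
      obtain ⟨h1, h2, h3⟩ := hcon
      have h4 : |1 / √α * (Y n ω - ∫ ω, Y n ω ∂(P n))| ≤ √q := by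
        rw [abs_mul, abs_of_nonneg (by positivity), one_div, inv_mul_le_iff₀ hsα]
        exact h3.le
      have h5 := heo n hn hS
      simp only [hd] at h5
      have h6 : X n ω - (CSPGlass.meanValue Λ + 1 / √α * Y n ω + e n)
          = o n + (X n ω - ∫ ω, X n ω ∂(P n)) - 1 / √α * (Y n ω - ∫ ω, Y n ω ∂(P n)) := by
        linarith
      have h7 := (abs_sub (o n + (X n ω - ∫ ω, X n ω ∂(P n)))
        (1 / √α * (Y n ω - ∫ ω, Y n ω ∂(P n)))).trans (add_le_add_left (abs_add_le _ _) _)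
      rw [← h6] at h7
      linarith
    have h1 := (measureReal_mono (μ := P n) hcover).trans
      ((measureReal_union_le _ _).trans (add_le_add_right (measureReal_union_le _ _) _))
    rw [probReal_univ] at h1
    have h2 : V₁ / 1 * q + V₂ / α * q = (V₁ + V₂ / α) * q := by ring
    linarith
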